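/- Let $P$ be an irreducible stochastic matrix on $E=\{1,2\}$ with invariant probability measure $\mu$, let $\lambda_1,\lambda_2\in(0,1)$, and let $g_1,g_2:[0,1]\to[0,1)$ be Lipschitz continuous with $g_j(z)>0$ for $z\in(0,1]$. For $x\in[0,1]^2$ and $i\in E$ let $p(x,i,\cdot)$ be the probability on $\mathcal V=\{\pm e_1,\pm e_2\}$ given by $$p(x,i,\pm e_1)=\tfrac12\lambda_i\,[1\mp g_1(x_1)],\qquad p(x,i,\pm e_2)=\tfrac12(1-\lambda_i)\,[1\mp g_2(x_2)],$$ and let $\bar f(x)=\sum_{v\in\mathcal V}\sum_{i\in E}\mu(i)\,p(x,i,v)\,v$. For $x\in[0,1]^2$ let $\mathcal N(x)$ be the set of vectors $n$ with $|n|=1$ such that $n_\ell=0$ if $x_\ell\in(0,1)$, $n_\ell\le 0$ if $x_\ell=0$, $n_\ell\ge0$ if $x_\ell=1$ (so $\mathcal N(x)=\emptyset$ in the interior). For a continuous $w:[0,T]\to\mathbb R^2$ with $w_0\in[0,1]^2$, write $\phi=\Psi(w)$ if $\phi:[0,T]\to[0,1]^2$ is continuous and $k=w-\phi$ is of bounded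 variation with $k_t=\int_0^t n_s\,d|k|_s$, where $n_s\in\mathcal N(\phi_s)$ for $d|k|$-a.e. $s$ (so $|k|$ grows only when $\phi$ is on the boundary). A solution of the averaged reflected equation started at $x$ is a path $\chi:[0,\infty)\to[0,1]^2$ with $\chi=\Psi\bigl(x+\int_0^\cdot\bar f(\chi_s)\,ds\bigr)$ on $[0,T]$ for every $T>0$. Let $\xi$ be the Markov chain with transition matrix $P$, and for fixed $x$ let $Y_1,Y_2,\dots$ be, given $\xi$, independent steps with $Y_k$ of law $p(x,\xi_k,\cdot)$. For $x\in[0,1]^2$ and $\alpha,v\in\mathbb R^2$ put $$H(x,\alpha)=\lim_{n\to\infty}\frac1n\ln\mathbb E\Bigl[e^{\langle\alpha,Y_1+\dots+Y_n\rangle}\Bigm|\xi_0=i\Bigr]$$ (the limit does not depend on $i\in E$), $L(x,v)=\sup_{\alpha}\{\langle\alpha,v\rangle-H(x,\alpha)\}\in[0,\infty]$, and let $L^{\rm ref}(x,v)$ be $+\infty$ if $\langle v,n\rangle>0$ for some $n\in\mathcal N(x)$; $L(x,v)$ if $\langle v,n\rangle<0$ for all $n\in\mathcal N(x)$ (in particular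 for $x$ in the interior); and $\inf\{L(x,v+\beta n):\beta\ge0,\ n\in\mathcal N(x),\ n\perp v\}$ otherwise. Let $$J_{0,T}(\phi)=\inf\Bigl\{\int_0^T L(\phi_s,\dot\psi_s)\,ds:\ \psi\text{ absolutely continuous},\ \Psi(\psi)=\phi\Bigr\},$$ and let the quasi-potential be $V(0,x)=\inf\{J_{0,T}(\phi):T>0,\ \phi\in C([0,T];[0,1]^2),\ \phi_0=0,\ \phi_T=x\}$. An optimal path from $0$ to $x$ is a continuous path $\varphi:(-\infty,0]\to[0,1]^2$ with $\lim_{t\to-\infty}\varphi_t=0$ and $\varphi_0=x$ that minimizes, among all such paths, $J_{-\infty,0}(\varphi)=\int_{-\infty}^0L^{\rm ref}(\varphi_t,\dot\varphi_t)\,dt$ (set to $+\infty$ if $\varphi$ is not absolutely continuous on bounded intervals). Then, for every $x\in[0,1]^2$, $$V(0,x)=W(x):=2\int_0^{x_1}\tanh^{-1}(g_1(y))\,dy+2\int_0^{x_2}\tanh^{-1}(g_2(y))\,dy .$$ Moreover, for every $x\in[0,1]^2\setminus\{0\}$, the averaged reflected equation started at $x$ has a unique solution $(\chi^x_t)_{t\ge0}$,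 and there is one and only one optimal path $(\varphi_t)_{t\le0}$ from $0$ to $x$; it is $\varphi_t=\chi^x_{-t}$, $t\le0$, and $J_{-\infty,0}(\varphi)=V(0,x)$. -/

import Mathlib

open MeasureTheory Filter Topology Set

noncomputable section

namespace ReflectedWalk

/-- Points of `ℝ^d`, with the Euclidean norm and scalar product. -/
abbrev Pt (d : ℕ) : Type := EuclideanSpace ℝ (Fin d)

/-- The hypercube `[0,1]^d`. -/
def cube (d : ℕ) : Set (Pt d) := {x | ∀ l, x l ∈ Icc (0 : ℝ) 1}

/-- The unit outward normals to the hypercube at `x`. The set is empty when `x` is an interior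
point, since then all the coordinates of `v` vanish. -/
def outwardNormals {d : ℕ} (x : Pt d) : Set (Pt d) :=
  {v | ‖v‖ = 1 ∧ ∀ l, (x l ∈ Ioo (0 : ℝ) 1 → v l = 0) ∧ (x l = 0 → v l ≤ 0) ∧
    (x l = 1 → 0 ≤ v l)}

/-- The Skorokhod problem on `[0,T]`: `x` is the reflection of `w` in the hypercube, `x = Ψ(w)`.
The pushing term is `k = w - x`, and `k_t = ∫_{(0,t]} n_s dν(s)` with `n_s` a unit outward normal
at `x_s` for `ν`-almost every `s`. Because `|n_s| = 1`, the measure `ν` is the total variation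
measure `d|k|` of `k`, so `k` has bounded variation; because there are no normals at interior
points, `ν` charges only the times at which `x` is on the boundary. -/
def IsReflection {d : ℕ} (T : ℝ) (w x : ℝ → Pt d) : Prop :=
  ContinuousOn w (Icc 0 T) ∧ ContinuousOn x (Icc 0 T) ∧ (∀ t ∈ Icc 0 T, x t ∈ cube d) ∧
  ∃ (ν : Measure ℝ) (n : ℝ → Pt d), IsFiniteMeasure ν ∧ Measurable n ∧
    (∀ᵐ s ∂(ν.restrict (Ioc 0 T)), n s ∈ outwardNormals (x s)) ∧
    ∀ t ∈ Icc 0 T, w t - x t = ∫ s in Ioc 0 t, n s ∂ν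

/-- `x` solves, on `[0,∞)`, the reflected differential equation with drift `b` started at `x₀`. -/
def IsReflectedSolution {d : ℕ} (b : Pt d → Pt d) (x₀ : Pt d) (x : ℝ → Pt d) : Prop :=
  ∀ T : ℝ, 0 < T → IsReflection T (fun t => x₀ + ∫ s in (0 : ℝ)..t, b (x s)) x

/-- Labels of the steps of the walk: `(j, true)` stands for `e_j`, `(j, false)` for `-e_j`. -/
abbrev Step (d : ℕ) : Type := Fin d × Bool

/-- The vector of a step. -/
def Step.vec {d : ℕ} (v : Step d) : Pt d :=
  EuclideanSpace.single v.1 (if v.2 then (1 : ℝ) else -1)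

section Environment

variable {d : ℕ} {E : Type} [Fintype E]

/-- The averaged drift: the mean of the step at `x` when the environment has law `μ`. -/
def averagedDrift (μ : E → ℝ) (p : Pt d → E → Step d → ℝ) (x : Pt d) : Pt d :=
  ∑ v : Step d, (∑ i, μ i * p x i v) • v.vec

/-- `𝔼^i exp ⟨α, ∑_{k=1}^n f(x, ξ_k, U_k)⟩`, where `ξ` is the Markov chain with transition matrix
`P` and `ξ_0 = i` and where, given the environment, the steps `f(x, ξ_k, U_k)` are independent with
laws `p(x, ξ_k, ·)`. The sum runs over all the values of `(ξ_1,…,ξ_n)` and of the `n` steps. -/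
def stepLaplace (P : Matrix E E ℝ) (p : Pt d → E → Step d → ℝ) (i : E) (x α : Pt d) (n : ℕ) : ℝ :=
  ∑ ξ : Fin n → E, ∑ v : Fin n → Step d,
    (∏ k : Fin n, P ((Fin.cons i ξ : Fin (n + 1) → E) k.castSucc) (ξ k) * p x (ξ k) (v k)) *
      Real.exp (inner ℝ α (∑ k, (v k).vec))

/-- The Hamiltonian `H(x,α)`, computed from the initial environment `i`. -/
def hamiltonian (P : Matrix E E ℝ) (p : Pt d → E → Step d → ℝ) (i : E) (x α : Pt d) : ℝ :=
  limUnder atTop (fun n : ℕ => (1 / (n : ℝ)) * Real.log (stepLaplace P p i x α n))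

/-- The Lagrangian `L(x,v) = sup_α (⟨α,v⟩ - H(x,α)) ∈ [0,∞]`. Since `H(x,0) = 0`, the supremum is
nonnegative and taking positive parts does not change it. -/
def lagrangian (P : Matrix E E ℝ) (p : Pt d → E → Step d → ℝ) (i : E) (x v : Pt d) : ENNReal :=
  ⨆ α : Pt d, ENNReal.ofReal (inner ℝ α v - hamiltonian P p i x α)

open Classical in
/-- The reflected Lagrangian. At an interior point there are no normals, the second case applies,
and the value is `L(x,v)`. -/
def reflectedLagrangian (P : Matrix E E ℝ) (p : Pt d → E → Step d → ℝ) (i : E) (x v : Pt d) :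
    ENNReal :=
  if ∃ n ∈ outwardNormals x, 0 < inner ℝ v n then ⊤
  else if ∀ n ∈ outwardNormals x, inner ℝ v n < 0 then lagrangian P p i x v
  else ⨅ (β : ℝ) (n : Pt d) (_ : 0 ≤ β) (_ : n ∈ outwardNormals x) (_ : inner ℝ n v = 0),
    lagrangian P p i x (v + β • n)

/-- The action functional `J_{0,T}(φ)` of the reflected walk: the infimum of
`∫_0^T L(φ_s, ψ'_s) ds` over the absolutely continuous `ψ` with `Ψ(ψ) = φ` (it is `∞` if there is
none). -/
def action (P : Matrix E E ℝ) (p : Pt d → E → Step d → ℝ) (i : E) (T : ℝ) (φ : ℝ → Pt d) :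
    ENNReal :=
  ⨅ (ψ : ℝ → Pt d) (_ : AbsolutelyContinuousOnInterval ψ 0 T) (_ : IsReflection T ψ φ),
    ∫⁻ s in Ioc 0 T, lagrangian P p i (φ s) (deriv ψ s)

/-- The quasi-potential `V(x,y)`. -/
def quasiPotential (P : Matrix E E ℝ) (p : Pt d → E → Step d → ℝ) (i : E) (x y : Pt d) : ENNReal :=
  ⨅ (T : ℝ) (φ : ℝ → Pt d) (_ : 0 < T) (_ : ContinuousOn φ (Icc 0 T))
    (_ : ∀ t ∈ Icc 0 T, φ t ∈ cube d) (_ : φ 0 = x) (_ : φ T = y), action P p i T φ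

open Classical in
/-- The action `J_{-∞,0}(φ)` of a path `(φ_t)_{t ≤ 0}`, infinite if the path is not absolutely
continuous on the bounded intervals of `(-∞,0]`. -/
def pastAction (P : Matrix E E ℝ) (p : Pt d → E → Step d → ℝ) (i : E) (φ : ℝ → Pt d) : ENNReal :=
  if ∀ T : ℝ, 0 < T → AbsolutelyContinuousOnInterval φ (-T) 0 then
    ∫⁻ t in Iic (0 : ℝ), reflectedLagrangian P p i (φ t) (deriv φ t)
  else ⊤

/-- `(φ_t)_{t ≤ 0}` is a continuous path in the hypercube from `0` (at time `-∞`) to `x` (at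
time `0`); the values of `φ` at positive times play no role. -/
def IsPastPath (x : Pt d) (φ : ℝ → Pt d) : Prop :=
  ContinuousOn φ (Iic 0) ∧ (∀ t ≤ 0, φ t ∈ cube d) ∧ φ 0 = x ∧ Tendsto φ atBot (𝓝 0)

/-- `(φ_t)_{t ≤ 0}` is an optimal path from `0` to `x`: it minimizes `J_{-∞,0}`. -/
def IsOptimalPath (P : Matrix E E ℝ) (p : Pt d → E → Step d → ℝ) (i : E) (x : Pt d)
    (φ : ℝ → Pt d) : Prop :=
  IsPastPath x φ ∧ ∀ ψ, IsPastPath x ψ → pastAction P p i φ ≤ pastAction P p i ψ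

/-- The jump probabilities of the two-stacks model: in the environment `i` the first coordinate
moves with probability `lam i`, the second one with probability `1 - lam i`; the coordinate `j`,
if it moves, goes up with probability `(1 - g_j(x_j)) / 2` and down with `(1 + g_j(x_j)) / 2`. -/
def twoStacks (lam : E → ℝ) (g : Fin 2 → ℝ → ℝ) (x : Pt 2) (i : E) (v : Step 2) : ℝ :=
  1 / 2 * (if v.1 = 0 then lam i else 1 - lam i) *
    (if v.2 then 1 - g v.1 (x v.1) else 1 + g v.1 (x v.1))

end Environment

/-- `W(x) = 2 ∫_0^{x_1} artanh(g_1) + 2 ∫_0^{x_2} artanh(g_2)`. -/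
def twoStacksPotential (g : Fin 2 → ℝ → ℝ) (x : Pt 2) : ℝ :=
  2 * (∫ y in (0 : ℝ)..x 0, Real.artanh (g 0 y)) + 2 * ∫ y in (0 : ℝ)..x 1, Real.artanh (g 1 y)

end ReflectedWalk

end

/-! The theorem rests on a symmetry. When the coordinate `l` moves, its step has moment generating
function `cosh a - γ sinh a = cosh (a - θ) / cosh θ`, with `γ = g_l(x_l)` and `θ = artanh γ`, which
is even about `θ`. Replacing `α_l` by `2θ - α_l` in any set of coordinates thus leaves the one-step
generating function unchanged in every environment, hence also `H(x,·)` (`hamiltonian_reflect`).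
Reflecting `0` shows that `∇W` lies in the zero level of `H(x,·)`, even after some of its components
are put to zero.

Lower bound. Let `p` be `∇W` with its components on the lower faces put to `0` (`optimalMomentum`).
Then `H(x,p) ≤ 0`, so `L(x,v) ≥ ⟨p,v⟩`. The boundary does not spoil this: a push at a face `x_l = 0`
meets `p_l = 0`, and a push at a face `x_l = 1` has a nonnegative product with `p_l`. Integrating
along a path started at `0`, or coming from `0` at time `-∞`, shows that it costs at least `W(x)`.

Upper bound. By Jensen's inequality and invariance of `μ`, `H(x,α) ≥ ⟨α, f̄(x)⟩`; reflecting `α` in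
the coordinates off the lower faces turns this into `L(x,w) ≤ ⟨p,w⟩`, where `w` is the reversed
drift in those coordinates and the drift itself in the others (`lagrangian_reversed_le`). The
outward components of `w` on the lower faces are cancelled by reflection and cost nothing. The
time-reversed averaged path therefore costs at most `W(x)`. It may need infinite time to leave `0`,
so for the quasi-potential its initial piece is replaced by a short straight line of negligible
cost.

Uniqueness. A second-order bound on `H` at `0`, built from the Poisson equation of the environment,
is reflected to a neighbourhood of `p`. It makes any velocity whose `l`-th component differs from
the optimal one strictly more expensive when `x_l ≠ 0` (`exists_excess_le_reflectedLagrangian`). A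
path of cost `W(x)` has no room for this excess, so, reversed in time, each of its coordinates
solves the scalar equation "go down at speed `b(u)` until `0`, then stay". This equation has one
solution for each initial value, and the solutions of the averaged reflected equation satisfy it
too. -/

namespace ReflectedWalk

noncomputable section

/-! ### The Hamiltonian as the growth rate of a tilted matrix -/

section Environment

variable {d : ℕ} {E : Type} [Fintype E]

/-- The moment generating function of one step made in the environment `j`. -/
def stepMgf (p : Pt d → E → Step d → ℝ) (x α : Pt d) (j : E) : ℝ :=
  ∑ v : Step d, p x j v * Real.exp (inner ℝ α v.vec)

lemma stepLaplace_eq_sum_prod (P : Matrix E E ℝ) (p : Pt d → E → Step d → ℝ) (i : E) (x α : Pt d)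
    (n : ℕ) : stepLaplace P p i x α n = ∑ ξ : Fin n → E,
      ∏ k : Fin n, P ((Fin.cons i ξ : Fin (n + 1) → E) k.castSucc) (ξ k) * stepMgf p x α (ξ k) := by
  unfold stepLaplace stepMgf
  refine Finset.sum_congr rfl fun ξ _ => ?_
  simp_rw [Finset.mul_sum]
  rw [Finset.prod_univ_sum, Fintype.piFinset_univ]
  refine Finset.sum_congr rfl fun v _ => ?_
  rw [inner_sum, Real.exp_sum, ← Finset.prod_mul_distrib]
  refine Finset.prod_congr rfl fun k _ => by ring

lemma stepLaplace_zero (P : Matrix E E ℝ) (p : Pt d → E → Step d → ℝ) (i : E) (x α : Pt d) :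
    stepLaplace P p i x α 0 = 1 := by
  simp [stepLaplace_eq_sum_prod]

/-- Conditioning on the first environment: `stepLaplace` iterates the tilted matrix `P i j * stepMgf
j` on the constant function `1`, which is why its positive eigenvectors govern the limit. -/
lemma stepLaplace_succ (P : Matrix E E ℝ) (p : Pt d → E → Step d → ℝ) (i : E) (x α : Pt d)
    (n : ℕ) : stepLaplace P p i x α (n + 1) =
      ∑ j, P i j * stepMgf p x α j * stepLaplace P p j x α n := by
  simp_rw [stepLaplace_eq_sum_prod, Finset.mul_sum]
  rw [← (Fin.consEquiv (fun _ : Fin (n + 1) => E)).sum_comp, Fintype.sum_prod_type]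
  refine Finset.sum_congr rfl fun j _ => Finset.sum_congr rfl fun ξ _ => ?_
  rw [Fin.prod_univ_succ]
  simp [Fin.consEquiv, Fin.castSucc_succ]

/-- The variable `α` enters only through the one-step generating functions, so a symmetry of these
passes to the Hamiltonian without any spectral theory, or even existence of the limit. -/
lemma hamiltonian_congr (P : Matrix E E ℝ) (p : Pt d → E → Step d → ℝ) (i : E) {x α β : Pt d}
    (h : ∀ j, stepMgf p x α j = stepMgf p x β j) :
    hamiltonian P p i x α = hamiltonian P p i x β := by
  unfold hamiltonian
  simp_rw [stepLaplace_eq_sum_prod, h]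

/-- A positive eigenvector of the tilted transition matrix computes the Hamiltonian. -/
lemma hamiltonian_eq_log (P : Matrix E E ℝ) (hP : ∀ i j, 0 ≤ P i j) (p : Pt d → E → Step d → ℝ)
    (i : E) (x α : Pt d) (hh : ∀ j, 0 ≤ stepMgf p x α j) {ρ : ℝ} (hρ : 0 < ρ) {r : E → ℝ}
    (hr : ∀ j, 0 < r j) (heig : ∀ i, ∑ j, P i j * stepMgf p x α j * r j = ρ * r i) :
    hamiltonian P p i x α = Real.log ρ := by
  -- The constant function `1`, which is the case `n = 0`, is squeezed between multiples `m r` and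
  -- `K r` of the eigenvector. Nonnegativity of the tilted matrix preserves the squeeze, with a
  -- factor `ρ` at each step, and the constants disappear in `(1/n) log`.
  obtain ⟨m, hm, hm'⟩ : ∃ m > 0, ∀ j, m * r j ≤ 1 := by
    refine ⟨(∑ j, r j + 1)⁻¹, ?_, fun j => ?_⟩
    · have := Finset.sum_nonneg (fun j (_ : j ∈ Finset.univ) => (hr j).le)
      positivity
    · have h1 := Finset.single_le_sum (fun j _ => (hr j).le) (Finset.mem_univ j)
      have h2 := (hr j)
      rw [inv_mul_le_iff₀ (by linarith)]
      linarith
  obtain ⟨K, hK, hK'⟩ : ∃ K > 0, ∀ j, 1 ≤ K * r j := by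
    refine ⟨∑ j, (r j)⁻¹, ?_, fun j => ?_⟩
    · exact Finset.sum_pos (fun j _ => inv_pos.2 (hr j)) ⟨i, Finset.mem_univ i⟩
    · have h1 := Finset.single_le_sum (f := fun j => (r j)⁻¹) (fun j _ => (inv_pos.2 (hr j)).le)
        (Finset.mem_univ j)
      calc (1 : ℝ) = (r j)⁻¹ * r j := (inv_mul_cancel₀ (hr j).ne').symm
        _ ≤ _ := mul_le_mul_of_nonneg_right h1 (hr j).le
  have hcoef : ∀ i j, 0 ≤ P i j * stepMgf p x α j := fun i j => mul_nonneg (hP i j) (hh j)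
  have hlow : ∀ n i, m * r i * ρ ^ n ≤ stepLaplace P p i x α n := by
    intro n
    induction n with
    | zero => intro i; simpa [stepLaplace_zero] using hm' i
    | succ n ih =>
      intro i
      rw [stepLaplace_succ]
      calc m * r i * ρ ^ (n + 1) = m * ρ ^ n * ∑ j, P i j * stepMgf p x α j * r j := by
            rw [heig]; ring
        _ = ∑ j, P i j * stepMgf p x α j * (m * r j * ρ ^ n) := by
            rw [Finset.mul_sum]; exact Finset.sum_congr rfl fun j _ => by ring
        _ ≤ _ := Finset.sum_le_sum fun j _ => mul_le_mul_of_nonneg_left (ih j) (hcoef i j)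
  have hup : ∀ n i, stepLaplace P p i x α n ≤ K * r i * ρ ^ n := by
    intro n
    induction n with
    | zero => intro i; simpa [stepLaplace_zero] using hK' i
    | succ n ih =>
      intro i
      rw [stepLaplace_succ]
      calc _ ≤ ∑ j, P i j * stepMgf p x α j * (K * r j * ρ ^ n) :=
            Finset.sum_le_sum fun j _ => mul_le_mul_of_nonneg_left (ih j) (hcoef i j)
        _ = K * ρ ^ n * ∑ j, P i j * stepMgf p x α j * r j := by
            rw [Finset.mul_sum]; exact Finset.sum_congr rfl fun j _ => by ring
        _ = _ := by rw [heig]; ring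
  have hlim : ∀ c : ℝ, 0 < c →
      Tendsto (fun n : ℕ => (1 / (n : ℝ)) * Real.log (c * ρ ^ n)) atTop (𝓝 (Real.log ρ)) := by
    intro c hc
    have h0 : Tendsto (fun n : ℕ => (1 / (n : ℝ)) * Real.log c + Real.log ρ) atTop
        (𝓝 (0 * Real.log c + Real.log ρ)) :=
      (tendsto_one_div_atTop_nhds_zero_nat.mul_const _).add_const _
    rw [zero_mul, zero_add] at h0
    refine h0.congr' ?_
    filter_upwards [eventually_gt_atTop 0] with n hn
    have hn' : (n : ℝ) ≠ 0 := by positivity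
    rw [Real.log_mul hc.ne' (by positivity), Real.log_pow]
    field_simp
  unfold hamiltonian
  apply Tendsto.limUnder_eq
  refine tendsto_of_tendsto_of_tendsto_of_le_of_le (hlim (m * r i) (mul_pos hm (hr i)))
    (hlim (K * r i) (mul_pos hK (hr i))) (fun n => ?_) (fun n => ?_)
  · have := mul_pos (mul_pos hm (hr i)) (pow_pos hρ n)
    exact mul_le_mul_of_nonneg_left (Real.log_le_log this (hlow n i)) (by positivity)
  · have := mul_pos (mul_pos hm (hr i)) (pow_pos hρ n)
    exact mul_le_mul_of_nonneg_left (Real.log_le_log (this.trans_le (hlow n i)) (hup n i))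
      (by positivity)

end Environment

/-! ### Perron eigenvalue bounds with two environments -/

section TwoStates

variable {P : Matrix (Fin 2) (Fin 2) ℝ}

lemma pos_of_isIrreducible_two (hirr : P.IsIrreducible) : 0 < P 0 1 ∧ 0 < P 1 0 := by
  have h := (Matrix.isIrreducible_iff_exists_pow_pos hirr.nonneg).1 hirr
  constructor
  · refine lt_of_le_of_ne (hirr.nonneg 0 1) fun h0 => ?_
    have key : ∀ k, (P ^ k) 0 1 = 0 := by
      intro k
      induction k with
      | zero => simp
      | succ k ih => rw [pow_succ, Matrix.mul_apply, Fin.sum_univ_two, ih, ← h0]; simp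
    obtain ⟨k, -, hk⟩ := h 0 1
    exact hk.ne' (key k)
  · refine lt_of_le_of_ne (hirr.nonneg 1 0) fun h0 => ?_
    have key : ∀ k, (P ^ k) 1 0 = 0 := by
      intro k
      induction k with
      | zero => simp
      | succ k ih => rw [pow_succ, Matrix.mul_apply, Fin.sum_univ_two, ih, ← h0]; simp
    obtain ⟨k, -, hk⟩ := h 1 0
    exact hk.ne' (key k)

/-- A `2 × 2` matrix with positive off-diagonal entries and a nonnegative diagonal entry has a
positive eigenvalue with a positive eigenvector. -/
lemma exists_pos_eigenvector {a b c e : ℝ} (hb : 0 < b) (hc : 0 < c) (he : 0 ≤ e) :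
    ∃ ρ > 0, ∃ r s : ℝ, 0 < r ∧ 0 < s ∧ a * r + b * s = ρ * r ∧ c * r + e * s = ρ * s := by
  -- The larger root of the characteristic polynomial is `ρ = (a + e + D) / 2`, with eigenvector
  -- `(b, ρ - a)`. Since `D > |a - e|`, `ρ - a` is positive and `ρ > e ≥ 0`.
  set D := √((a - e) ^ 2 + 4 * (b * c)) with hD
  have hbc := mul_pos hb hc
  have hD2 : D ^ 2 = (a - e) ^ 2 + 4 * (b * c) := Real.sq_sqrt (by positivity)
  have hDa : |a - e| < D := by
    rw [hD]; apply Real.lt_sqrt_of_sq_lt; rw [sq_abs]; linarith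
  rw [abs_lt] at hDa
  refine ⟨(a + e + D) / 2, by linarith, b, (e - a + D) / 2, hb, by linarith,
    by ring, ?_⟩
  nlinarith

/-- The Hamiltonian is the logarithm of the Perron eigenvalue of the tilted matrix. -/
lemma exists_eigen_hamiltonian {d : ℕ} (hirr : P.IsIrreducible)
    (p : Pt d → Fin 2 → Step d → ℝ) (i : Fin 2) (x α : Pt d) (hh : ∀ j, 0 < stepMgf p x α j) :
    ∃ ρ > 0, ∃ r : Fin 2 → ℝ, (∀ j, 0 < r j) ∧
      (∀ i, ∑ j, P i j * stepMgf p x α j * r j = ρ * r i) ∧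
      hamiltonian P p i x α = Real.log ρ := by
  obtain ⟨h01, h10⟩ := pos_of_isIrreducible_two hirr
  obtain ⟨ρ, hρ, r, s, hr, hs, h1, h2⟩ := exists_pos_eigenvector
    (a := P 0 0 * stepMgf p x α 0) (mul_pos h01 (hh 1)) (mul_pos h10 (hh 0))
    (mul_nonneg (hirr.nonneg 1 1) (hh 1).le)
  have hpos : ∀ j, 0 < (![r, s] : Fin 2 → ℝ) j := by
    intro j; fin_cases j <;> simpa
  have heig : ∀ i, ∑ j, P i j * stepMgf p x α j * (![r, s] : Fin 2 → ℝ) j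
      = ρ * (![r, s] : Fin 2 → ℝ) i := by
    intro i; fin_cases i <;> simpa [Fin.sum_univ_two]
  exact ⟨ρ, hρ, ![r, s], hpos, heig,
    hamiltonian_eq_log P hirr.nonneg p i x α (fun j => (hh j).le) hρ hpos heig⟩

/-- Jensen's inequality for the Perron eigenvalue. -/
lemma sum_log_stepMgf_le_hamiltonian {d : ℕ} (hP : P ∈ Matrix.rowStochastic ℝ (Fin 2))
    (hirr : P.IsIrreducible) {μ : Fin 2 → ℝ} (hμ0 : ∀ i, 0 ≤ μ i) (hμ1 : ∑ i, μ i = 1)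
    (hμ : Matrix.vecMul μ P = μ)
    (p : Pt d → Fin 2 → Step d → ℝ) (i : Fin 2) (x α : Pt d) (hh : ∀ j, 0 < stepMgf p x α j) :
    ∑ j, μ j * Real.log (stepMgf p x α j) ≤ hamiltonian P p i x α := by
  obtain ⟨ρ, hρ, r, hr, heig, hH⟩ := exists_eigen_hamiltonian hirr p i x α hh
  rw [hH]
  have hrow := fun i => Matrix.sum_row_of_mem_rowStochastic hP i
  have hjen : ∀ i, ∑ j, P i j * (Real.log (stepMgf p x α j) + Real.log (r j)) ≤
      Real.log ρ + Real.log (r i) := by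
    intro i
    have := strictConcaveOn_log_Ioi.concaveOn.le_map_sum (t := Finset.univ) (w := P i)
      (p := fun j => stepMgf p x α j * r j) (fun j _ => hirr.nonneg i j) (hrow i)
      (fun j _ => mul_pos (hh j) (hr j))
    simp only [smul_eq_mul, ← mul_assoc] at this
    rw [heig, Real.log_mul hρ.ne' (hr i).ne'] at this
    refine le_trans (le_of_eq ?_) this
    exact Finset.sum_congr rfl fun j _ => by rw [Real.log_mul (hh j).ne' (hr j).ne']
  -- Averaging the rows of `hjen` over `μ` makes the terms in `log r` cancel, by invariance.
  have h0 := mul_le_mul_of_nonneg_left (hjen 0) (hμ0 0)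
  have h1 := mul_le_mul_of_nonneg_left (hjen 1) (hμ0 1)
  have e0 := congrFun hμ 0
  have e1 := congrFun hμ 1
  simp only [Matrix.vecMul, dotProduct, Fin.sum_univ_two] at e0 e1 h0 h1 hμ1 ⊢
  set l0 := Real.log (stepMgf p x α 0)
  set l1 := Real.log (stepMgf p x α 1)
  set r0 := Real.log (r 0)
  set r1 := Real.log (r 1)
  have : μ 0 * l0 + μ 1 * l1 + μ 0 * r0 + μ 1 * r1 ≤ Real.log ρ + μ 0 * r0 + μ 1 * r1 := by
    calc _ = (μ 0 * P 0 0 + μ 1 * P 1 0) * (l0 + r0) + (μ 0 * P 0 1 + μ 1 * P 1 1) * (l1 + r1) := by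
            rw [e0, e1]; ring
      _ ≤ (μ 0 + μ 1) * Real.log ρ + μ 0 * r0 + μ 1 * r1 := by linarith
      _ = _ := by rw [hμ1]; ring
  linarith

/-- A positive supersolution bounds the Hamiltonian from above. -/
lemma hamiltonian_le_sub_one {d : ℕ} (hirr : P.IsIrreducible)
    (p : Pt d → Fin 2 → Step d → ℝ) (i : Fin 2) (x α : Pt d) (hh : ∀ j, 0 < stepMgf p x α j)
    {ρ' : ℝ} {r' : Fin 2 → ℝ} (hr' : ∀ j, 0 < r' j)
    (hsup : ∀ i, ∑ j, P i j * stepMgf p x α j * r' j ≤ ρ' * r' i) :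
    hamiltonian P p i x α ≤ ρ' - 1 := by
  obtain ⟨ρ, hρ, r, hr, heig, hH⟩ := exists_eigen_hamiltonian hirr p i x α hh
  rw [hH]
  refine (Real.log_le_sub_one_of_pos hρ).trans (sub_le_sub_right ?_ 1)
  -- Collatz–Wielandt argument: at the index maximizing `r / r'`, the eigenvalue equation for `r`
  -- and the supersolution inequality for `r'` give `ρ ≤ ρ'`.
  obtain ⟨k, -, hk⟩ := Finset.exists_max_image Finset.univ (fun j => r j / r' j)
    ⟨i, Finset.mem_univ i⟩
  have hm : ∀ j, r j ≤ r k / r' k * r' j := fun j => by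
    rw [← div_le_iff₀ (hr' j)]; exact hk j (Finset.mem_univ j)
  have : ρ * r k ≤ ρ' * r k := by
    calc ρ * r k = ∑ j, P k j * stepMgf p x α j * r j := (heig k).symm
      _ ≤ ∑ j, P k j * stepMgf p x α j * (r k / r' k * r' j) :=
        Finset.sum_le_sum fun j _ => mul_le_mul_of_nonneg_left (hm j)
          (mul_nonneg (hirr.nonneg k j) (hh j).le)
      _ = r k / r' k * ∑ j, P k j * stepMgf p x α j * r' j := by
        rw [Finset.mul_sum]; exact Finset.sum_congr rfl fun j _ => by ring
      _ ≤ r k / r' k * (ρ' * r' k) :=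
        mul_le_mul_of_nonneg_left (hsup k) (div_pos (hr k) (hr' k)).le
      _ = ρ' * r k := by have := (hr' k).ne'; field_simp
  exact le_of_mul_le_mul_right this (hr k)

end TwoStates

/-! ### The two-stacks Hamiltonian: symmetry, tangent bound, coercivity, expansion at zero -/

/-- The standing assumptions on the two-stacks model. -/
structure TwoStacksModel (P : Matrix (Fin 2) (Fin 2) ℝ) (μ lam : Fin 2 → ℝ) (g : Fin 2 → ℝ → ℝ) :
    Prop where
  stochastic : P ∈ Matrix.rowStochastic ℝ (Fin 2)
  irreducible : P.IsIrreducible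
  nonneg : ∀ i, 0 ≤ μ i
  sum_eq_one : ∑ i, μ i = 1
  invariant : Matrix.vecMul μ P = μ
  lam_mem : ∀ i, lam i ∈ Set.Ioo (0 : ℝ) 1
  lipschitz : ∀ j, ∃ K : NNReal, LipschitzOnWith K (g j) (Set.Icc 0 1)
  mem_Ico : ∀ j, ∀ z ∈ Set.Icc (0 : ℝ) 1, g j z ∈ Set.Ico (0 : ℝ) 1
  pos : ∀ j, ∀ z ∈ Set.Ioc (0 : ℝ) 1, 0 < g j z

/-- The moment generating function of a `±1` step with mean `-γ`. -/
def tilt (γ a : ℝ) : ℝ := Real.cosh a - γ * Real.sinh a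

lemma tilt_eq (γ a : ℝ) :
    tilt γ a = (1 - γ) / 2 * Real.exp a + (1 + γ) / 2 * Real.exp (-a) := by
  rw [tilt, Real.cosh_eq, Real.sinh_eq]; ring

@[simp]
lemma tilt_zero (γ : ℝ) : tilt γ 0 = 1 := by simp [tilt]

lemma tilt_pos {γ : ℝ} (hγ : γ ∈ Ico (0 : ℝ) 1) (a : ℝ) : 0 < tilt γ a := by
  have h1 := hγ.1
  have h2 := hγ.2
  rw [tilt_eq]
  exact add_pos (mul_pos (by linarith) (Real.exp_pos _)) (mul_pos (by linarith) (Real.exp_pos _))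

/-- Both signs of the step have probability at least `(1 - γ) / 2`; this is the source of the
coercivity of the Hamiltonian. -/
lemma exp_abs_le_tilt {γ : ℝ} (hγ : γ ∈ Ico (0 : ℝ) 1) (a : ℝ) :
    (1 - γ) / 2 * Real.exp |a| ≤ tilt γ a := by
  have h1 := hγ.1
  have h2 := hγ.2
  have e1 := Real.exp_pos a
  have e2 := Real.exp_pos (-a)
  rw [tilt_eq]
  rcases abs_cases a with ⟨h, -⟩ | ⟨h, -⟩ <;> rw [h] <;> nlinarith

lemma exp_le_tilt {γ : ℝ} (hγ : γ ∈ Ico (0 : ℝ) 1) (a : ℝ) : Real.exp (-(γ * a)) ≤ tilt γ a := by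
  have h1 := hγ.1
  have h2 := hγ.2
  have := convexOn_exp.2 (mem_univ a) (mem_univ (-a)) (show 0 ≤ (1 - γ) / 2 by linarith)
    (show 0 ≤ (1 + γ) / 2 by linarith) (by ring)
  rw [tilt_eq]
  simp only [smul_eq_mul] at this
  refine le_trans (le_of_eq ?_) this
  congr 1
  ring

/-- With `θ = artanh γ` one has `sinh θ = γ cosh θ`, so `tilt γ a = cosh (a - θ) / cosh θ` is even
about `θ`. -/
lemma tilt_reflect {γ : ℝ} (hγ : γ ∈ Ico (0 : ℝ) 1) (a : ℝ) :
    tilt γ (2 * Real.artanh γ - a) = tilt γ a := by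
  set θ := Real.artanh γ with hθ
  have ht : Real.sinh θ = γ * Real.cosh θ := by
    have := Real.tanh_artanh (x := γ) ⟨by linarith [hγ.1], hγ.2⟩
    rw [← hθ, Real.tanh_eq_sinh_div_cosh, div_eq_iff (Real.cosh_pos θ).ne'] at this
    exact this
  obtain ⟨b, rfl⟩ : ∃ b, a = θ - b := ⟨θ - a, by ring⟩
  have e1 : 2 * θ - (θ - b) = θ + b := by ring
  rw [e1, tilt, tilt, Real.cosh_add, Real.sinh_add, Real.cosh_sub, Real.sinh_sub, ht]
  ring

lemma abs_tilt_sub_one_add_le {γ : ℝ} (hγ : γ ∈ Ico (0 : ℝ) 1) {a : ℝ} (ha : |a| ≤ 1) :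
    |tilt γ a - 1 + γ * a| ≤ a ^ 2 := by
  have h1 := hγ.1
  have h2 := hγ.2
  have e1 := abs_le.1 (Real.abs_exp_sub_one_sub_id_le ha)
  have e2 := abs_le.1 (Real.abs_exp_sub_one_sub_id_le (x := -a) (by rwa [abs_neg]))
  rw [neg_sq] at e2
  rw [tilt_eq, abs_le]
  constructor <;> nlinarith [e1.1, e1.2, e2.1, e2.2]

/-- The probability that the coordinate `l` moves in the environment `i`. -/
def moveProb (lam : Fin 2 → ℝ) (l i : Fin 2) : ℝ := if l = 0 then lam i else 1 - lam i

/-- The mean probability that the coordinate `l` moves. -/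
def speed (μ lam : Fin 2 → ℝ) (l : Fin 2) : ℝ := ∑ i, μ i * moveProb lam l i

lemma stepMgf_twoStacks (lam : Fin 2 → ℝ) (g : Fin 2 → ℝ → ℝ) (x α : Pt 2) (j : Fin 2) :
    stepMgf (twoStacks lam g) x α j = ∑ l, moveProb lam l j * tilt (g l (x l)) (α l) := by
  simp only [stepMgf, twoStacks, Step.vec, Fintype.sum_prod_type, Fintype.sum_bool,
    EuclideanSpace.inner_single_right, moveProb, tilt_eq]
  refine Finset.sum_congr rfl fun l _ => ?_
  fin_cases l <;> simp <;> ring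

lemma averagedDrift_twoStacks (μ lam : Fin 2 → ℝ) (g : Fin 2 → ℝ → ℝ) (x : Pt 2) (l : Fin 2) :
    averagedDrift μ (twoStacks lam g) x l = -(speed μ lam l * g l (x l)) := by
  simp only [averagedDrift, twoStacks, Step.vec, Fintype.sum_prod_type, Fintype.sum_bool,
    Fin.sum_univ_two, speed, moveProb]
  fin_cases l <;> simp <;> ring

namespace TwoStacksModel

variable {P : Matrix (Fin 2) (Fin 2) ℝ} {μ lam : Fin 2 → ℝ} {g : Fin 2 → ℝ → ℝ}

lemma moveProb_pos (M : TwoStacksModel P μ lam g) (l j : Fin 2) : 0 < moveProb lam l j := by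
  have := M.lam_mem j
  unfold moveProb
  split_ifs <;> linarith [this.1, this.2]

lemma speed_pos (M : TwoStacksModel P μ lam g) (l : Fin 2) : 0 < speed μ lam l := by
  have h1 := M.sum_eq_one
  have h0 := M.moveProb_pos l
  have hn := M.nonneg
  have : ∃ i, μ i ≠ 0 := by
    by_contra! h
    simp [h] at h1
  obtain ⟨i, hi⟩ := this
  exact Finset.sum_pos' (fun j _ => mul_nonneg (hn j) (h0 j).le)
    ⟨i, Finset.mem_univ i, mul_pos (lt_of_le_of_ne (hn i) hi.symm) (h0 i)⟩

lemma sum_moveProb (lam : Fin 2 → ℝ) (j : Fin 2) : ∑ l, moveProb lam l j = 1 := by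
  simp [moveProb]

lemma stepMgf_pos (M : TwoStacksModel P μ lam g) {x : Pt 2} (hx : x ∈ cube 2) (α : Pt 2)
    (j : Fin 2) : 0 < stepMgf (twoStacks lam g) x α j := by
  rw [stepMgf_twoStacks]
  exact Finset.sum_pos (fun l _ => mul_pos (M.moveProb_pos l j)
    (tilt_pos (M.mem_Ico l _ (hx l)) _)) Finset.univ_nonempty

/-- The Hamiltonian is invariant under the reflection of each coordinate about `artanh g`. -/
lemma hamiltonian_reflect (M : TwoStacksModel P μ lam g) {x : Pt 2} (hx : x ∈ cube 2)
    (i : Fin 2) {α β : Pt 2}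
    (h : ∀ l, α l = β l ∨ α l = 2 * Real.artanh (g l (x l)) - β l) :
    hamiltonian P (twoStacks lam g) i x α = hamiltonian P (twoStacks lam g) i x β := by
  refine hamiltonian_congr _ _ _ fun j => ?_
  rw [stepMgf_twoStacks, stepMgf_twoStacks]
  refine Finset.sum_congr rfl fun l _ => ?_
  rcases h l with h | h
  · rw [h]
  · rw [h, tilt_reflect (M.mem_Ico l _ (hx l))]

/-- The Hamiltonian lies above its tangent at `0`, whose slope is the averaged drift. This is
Jensen's inequality applied to the sign of the step, to the coordinate that moves, and to the
environment. -/
lemma sum_mul_drift_le_hamiltonian (M : TwoStacksModel P μ lam g) {x : Pt 2} (hx : x ∈ cube 2)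
    (i : Fin 2) (α : Pt 2) :
    ∑ l, α l * -(speed μ lam l * g l (x l)) ≤ hamiltonian P (twoStacks lam g) i x α := by
  refine le_trans ?_ (sum_log_stepMgf_le_hamiltonian M.stochastic M.irreducible M.nonneg
    M.sum_eq_one M.invariant _ i x α (M.stepMgf_pos hx α))
  have key : ∀ j, ∑ l, moveProb lam l j * -(g l (x l) * α l) ≤
      Real.log (stepMgf (twoStacks lam g) x α j) := by
    intro j
    rw [Real.le_log_iff_exp_le (M.stepMgf_pos hx α j), stepMgf_twoStacks]
    have := convexOn_exp.map_sum_le (t := Finset.univ) (w := fun l => moveProb lam l j)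
      (p := fun l => -(g l (x l) * α l)) (fun l _ => (M.moveProb_pos l j).le)
      (sum_moveProb lam j) (fun _ _ => mem_univ _)
    simp only [smul_eq_mul] at this
    exact this.trans (Finset.sum_le_sum fun l _ => mul_le_mul_of_nonneg_left
      (exp_le_tilt (M.mem_Ico l _ (hx l)) _) (M.moveProb_pos l j).le)
  refine le_trans (le_of_eq ?_)
    (Finset.sum_le_sum fun j _ => mul_le_mul_of_nonneg_left (key j) (M.nonneg j))
  simp only [speed, Fin.sum_univ_two]
  ring

/-- In every environment the step along `e_l` of the same sign as `α l` has probability bounded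
below uniformly in `x`, since the continuous function `g l` stays away from `1` on the compact
interval. -/
lemma exists_abs_sub_le_hamiltonian (M : TwoStacksModel P μ lam g) (i : Fin 2) :
    ∃ K : ℝ, ∀ x ∈ cube 2, ∀ (α : Pt 2) (l : Fin 2),
      |α l| - K ≤ hamiltonian P (twoStacks lam g) i x α := by
  have hgap : ∀ l, ∃ δ > 0, ∀ z ∈ Icc (0 : ℝ) 1, ∀ j, δ ≤ moveProb lam l j * ((1 - g l z) / 2) := by
    intro l
    obtain ⟨K, hK⟩ := M.lipschitz l
    obtain ⟨z₀, hz₀, hmax⟩ := isCompact_Icc.exists_isMaxOn (nonempty_Icc.2 zero_le_one)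
      hK.continuousOn
    have h0 := M.moveProb_pos l 0
    have h1 := M.moveProb_pos l 1
    refine ⟨min (moveProb lam l 0) (moveProb lam l 1) * ((1 - g l z₀) / 2),
      mul_pos (lt_min h0 h1) (by linarith [(M.mem_Ico l z₀ hz₀).2]), fun z hz j => ?_⟩
    have hz' : g l z ≤ g l z₀ := hmax hz
    refine mul_le_mul ?_ (by linarith) (by linarith [(M.mem_Ico l z₀ hz₀).2])
      (M.moveProb_pos l j).le
    fin_cases j
    · exact min_le_left _ _
    · exact min_le_right _ _
  choose δ hδ hδ' using hgap
  have hb : ∀ x ∈ cube 2, ∀ (α : Pt 2) (l : Fin 2),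
      |α l| - -Real.log (δ l) ≤ hamiltonian P (twoStacks lam g) i x α := by
    intro x hx α l
    refine le_trans ?_ (sum_log_stepMgf_le_hamiltonian M.stochastic M.irreducible M.nonneg
      M.sum_eq_one M.invariant _ i x α (M.stepMgf_pos hx α))
    have key : ∀ j, |α l| - -Real.log (δ l) ≤ Real.log (stepMgf (twoStacks lam g) x α j) := by
      intro j
      have e : |α l| - -Real.log (δ l) = Real.log (δ l * Real.exp |α l|) := by
        rw [Real.log_mul (hδ l).ne' (Real.exp_pos _).ne', Real.log_exp]; ring
      rw [e]
      refine Real.log_le_log (mul_pos (hδ l) (Real.exp_pos _)) ?_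
      rw [stepMgf_twoStacks]
      calc δ l * Real.exp |α l| ≤ moveProb lam l j * ((1 - g l (x l)) / 2) * Real.exp |α l| :=
            mul_le_mul_of_nonneg_right (hδ' l _ (hx l) j) (Real.exp_pos _).le
        _ = moveProb lam l j * ((1 - g l (x l)) / 2 * Real.exp |α l|) := by ring
        _ ≤ moveProb lam l j * tilt (g l (x l)) (α l) := mul_le_mul_of_nonneg_left
            (exp_abs_le_tilt (M.mem_Ico l _ (hx l)) _) (M.moveProb_pos l j).le
        _ ≤ _ := Finset.single_le_sum (f := fun l => moveProb lam l j * tilt (g l (x l)) (α l))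
            (fun l _ => mul_nonneg (M.moveProb_pos l j).le
              (tilt_pos (M.mem_Ico l _ (hx l)) _).le) (Finset.mem_univ l)
    calc _ = ∑ j, μ j * (|α l| - -Real.log (δ l)) := by
          rw [← Finset.sum_mul, M.sum_eq_one, one_mul]
      _ ≤ _ := Finset.sum_le_sum fun j _ => mul_le_mul_of_nonneg_left (key j) (M.nonneg j)
  refine ⟨max (-Real.log (δ 0)) (-Real.log (δ 1)), fun x hx α l => le_trans ?_ (hb x hx α l)⟩
  refine sub_le_sub_left ?_ _
  fin_cases l
  · exact le_max_left _ _
  · exact le_max_right _ _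

/-- Solvability of the Poisson equation for the environment. -/
lemma exists_poisson (M : TwoStacksModel P μ lam g) (w : Fin 2 → ℝ) :
    ∃ Q : Fin 2 → ℝ, ∀ i, ∑ j, P i j * (w j + Q j) = ∑ j, μ j * w j + Q i := by
  obtain ⟨h01, h10⟩ := pos_of_isIrreducible_two M.irreducible
  have r0 := Matrix.sum_row_of_mem_rowStochastic M.stochastic 0
  have r1 := Matrix.sum_row_of_mem_rowStochastic M.stochastic 1
  have hs := M.sum_eq_one
  have e0 := congrFun M.invariant 0
  simp only [Matrix.vecMul, dotProduct, Fin.sum_univ_two] at e0 r0 r1 hs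
  set c := μ 0 * w 0 + μ 1 * w 1 with hc
  -- Solutions are defined up to a constant, so `Q 0 = 0`; row `0` then fixes `Q 1`, and row `1` is
  -- compatible because of the balance `μ 0 * P 0 1 = μ 1 * P 1 0`.
  refine ⟨![0, (c - (P 0 0 * w 0 + P 0 1 * w 1)) / P 0 1], fun i => ?_⟩
  have hP00 : P 0 0 = 1 - P 0 1 := by linarith
  have hP11 : P 1 1 = 1 - P 1 0 := by linarith
  have hm : μ 0 * P 0 1 = μ 1 * P 1 0 := by rw [hP00] at e0; linarith
  have hm0 : μ 0 = 1 - μ 1 := by linarith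
  fin_cases i
  · simp [Fin.sum_univ_two, ← hc]
    field_simp
    ring
  · simp [Fin.sum_univ_two, ← hc]
    field_simp
    rw [hP11, hP00, hc]
    rw [hm0] at hm ⊢
    have hm1 : μ 1 * (P 0 1 + P 1 0) = P 0 1 := by linarith
    linear_combination (w 0 - w 1) * hm1

/-- The second order upper bound of the Hamiltonian at `α = 0` along the coordinate axes. -/
lemma exists_hamiltonian_single_le (M : TwoStacksModel P μ lam g) (i : Fin 2) (l : Fin 2) :
    ∃ C ≥ 0, ∃ κ > 0, ∀ x ∈ cube 2, ∀ a : ℝ, |a| ≤ κ →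
      hamiltonian P (twoStacks lam g) i x (EuclideanSpace.single l a) ≤
        -(speed μ lam l * g l (x l)) * a + C * a ^ 2 := by
  -- First-order perturbation: with `s = tilt γ a - 1`, the tilted matrix is `P i j * (1 + moveProb
  -- j * s)`, and the corrector `1 + s Q` is an eigenvector up to `O(s²)`, for the eigenvalue `1 + c
  -- s`.
  obtain ⟨Q, hQ⟩ := M.exists_poisson (moveProb lam l)
  change ∀ i, _ = speed μ lam l + Q i at hQ
  set c := speed μ lam l with hc
  have hcpos : 0 < c := M.speed_pos l
  have hw1 : ∀ j, moveProb lam l j ≤ 1 := fun j => by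
    rw [← sum_moveProb lam j]
    exact Finset.single_le_sum (f := fun l => moveProb lam l j)
      (fun l _ => (M.moveProb_pos l j).le) (Finset.mem_univ l)
  obtain ⟨B, hB1, hcB, hBQ⟩ : ∃ B ≥ 1, c ≤ B ∧ ∀ j, |Q j| ≤ B := by
    refine ⟨1 + c + |Q 0| + |Q 1|, ?_, ?_, fun j => ?_⟩
    · linarith [abs_nonneg (Q 0), abs_nonneg (Q 1)]
    · linarith [abs_nonneg (Q 0), abs_nonneg (Q 1)]
    · fin_cases j <;> simp <;> linarith [abs_nonneg (Q 0), abs_nonneg (Q 1)]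
  -- The choice of `κ` gives `|s Q| ≤ 1/2`, which keeps the test vector positive. In `C`, the term
  -- `c` pays for replacing `s` by `-γ a`, and `16 = 4 * 4` comes from `s ^ 2 ≤ 4 * a ^ 2`.
  refine ⟨c + 16 * (B + B ^ 2), by positivity, 1 / (4 * B), by positivity, fun x hx a ha => ?_⟩
  have hγ := M.mem_Ico l _ (hx l)
  set γ := g l (x l) with hγdef
  have hB0 : 0 < B := by linarith
  have ha1 : |a| ≤ 1 := ha.trans (by rw [div_le_one (by positivity)]; linarith)
  have haB : B * |a| ≤ 1 / 4 := by
    rw [le_div_iff₀ (by positivity)] at ha; linarith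
  set s := tilt γ a - 1 with hs
  have hsa : |s + γ * a| ≤ a ^ 2 := abs_tilt_sub_one_add_le hγ ha1
  have hs2 : |s| ≤ 2 * |a| := by
    have h1 : |s| ≤ |s + γ * a| + |γ * a| := by
      calc |s| = |(s + γ * a) - γ * a| := by ring_nf
        _ ≤ _ := abs_sub _ _
    have h2 : |γ * a| ≤ |a| := by
      rw [abs_mul, abs_of_nonneg hγ.1]
      exact mul_le_of_le_one_left (abs_nonneg a) hγ.2.le
    have h3 : a ^ 2 ≤ |a| := by
      rw [← sq_abs]; nlinarith [abs_nonneg a]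
    linarith
  have hsQ : ∀ j, |s * Q j| ≤ 1 / 2 := fun j => by
    rw [abs_mul]
    calc |s| * |Q j| ≤ (2 * |a|) * B := mul_le_mul hs2 (hBQ j) (abs_nonneg _) (by positivity)
      _ ≤ 1 / 2 := by linarith
  have hmgf : ∀ j, stepMgf (twoStacks lam g) x (EuclideanSpace.single l a) j
      = 1 + moveProb lam l j * s := by
    intro j
    have h1 := sum_moveProb lam j
    rw [stepMgf_twoStacks, hs, hγdef]
    simp only [Fin.sum_univ_two] at h1 ⊢
    fin_cases l <;> simp <;> linear_combination h1
  have hup := hamiltonian_le_sub_one M.irreducible (twoStacks lam g) i x (EuclideanSpace.single l a)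
    (M.stepMgf_pos hx _) (ρ' := 1 + c * s + 4 * (B + B ^ 2) * s ^ 2) (r' := fun j => 1 + s * Q j)
    (fun j => by linarith [(abs_le.1 (hsQ j)).1]) (fun k => by
      simp only [hmgf]
      have hrow := Matrix.sum_row_of_mem_rowStochastic M.stochastic k
      have e1 : ∑ j, P k j * (1 + moveProb lam l j * s) * (1 + s * Q j) =
          1 + s * (c + Q k) + s ^ 2 * ∑ j, P k j * (moveProb lam l j * Q j) := by
        rw [← hQ k]
        simp only [Fin.sum_univ_two] at hrow ⊢
        linear_combination hrow
      have e2 : ∑ j, P k j * (moveProb lam l j * Q j) ≤ B := by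
        calc _ ≤ ∑ j, P k j * B := Finset.sum_le_sum fun j _ =>
              mul_le_mul_of_nonneg_left (by
                calc moveProb lam l j * Q j ≤ moveProb lam l j * B :=
                      mul_le_mul_of_nonneg_left ((le_abs_self _).trans (hBQ j))
                        (M.moveProb_pos l j).le
                  _ ≤ B := mul_le_of_le_one_left hB0.le (hw1 j)) (M.irreducible.nonneg k j)
          _ = B := by rw [← Finset.sum_mul, hrow, one_mul]
      have e3 : -(B ^ 2) ≤ c * Q k := by
        have := (abs_le.1 (hBQ k)).1
        nlinarith
      have e4 := (abs_le.1 (hsQ k)).1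
      rw [e1]
      have h5 : s ^ 2 * ∑ j, P k j * (moveProb lam l j * Q j) ≤ s ^ 2 * B :=
        mul_le_mul_of_nonneg_left e2 (sq_nonneg s)
      have h6 : -(s ^ 2 * B ^ 2) ≤ s ^ 2 * (c * Q k) := by
        nlinarith [mul_le_mul_of_nonneg_left e3 (sq_nonneg s)]
      have h7 : 4 * (B + B ^ 2) * s ^ 2 * (1 / 2) ≤ 4 * (B + B ^ 2) * s ^ 2 * (1 + s * Q k) :=
        mul_le_mul_of_nonneg_left (by linarith) (by positivity)
      nlinarith [mul_nonneg hB0.le (sq_nonneg s), mul_nonneg (sq_nonneg B) (sq_nonneg s)])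
  have h8 : c * s ≤ -(c * γ) * a + c * a ^ 2 := by
    have := mul_le_mul_of_nonneg_left (abs_le.1 hsa).2 hcpos.le
    linarith
  have h9 : s ^ 2 ≤ 4 * a ^ 2 := by
    rw [← sq_abs s, ← sq_abs a]; nlinarith [abs_nonneg s, abs_nonneg a]
  have h10 : 4 * (B + B ^ 2) * s ^ 2 ≤ 4 * (B + B ^ 2) * (4 * a ^ 2) :=
    mul_le_mul_of_nonneg_left h9 (by positivity)
  linarith

end TwoStacksModel

/-! ### Bounds on the Lagrangian and the reflected Lagrangian -/

lemma inner_eq_sum {d : ℕ} (x y : Pt d) : inner ℝ x y = ∑ l, x l * y l := by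
  simp [PiLp.inner_apply, mul_comm]

section Environment

variable {d : ℕ} {E : Type} [Fintype E] {P : Matrix E E ℝ} {p : Pt d → E → Step d → ℝ} {i : E}

lemma le_lagrangian (x v α : Pt d) :
    ENNReal.ofReal (∑ l, α l * v l - hamiltonian P p i x α) ≤ lagrangian P p i x v := by
  rw [← inner_eq_sum]
  exact le_iSup (fun α => ENNReal.ofReal (inner ℝ α v - hamiltonian P p i x α)) α

/-- A dual vector satisfying the two sign conditions has a nonnegative product with every outward
normal, so adding a push `β n` to `v` cannot lower the dual bound. -/
lemma le_reflectedLagrangian {x α : Pt d} (v : Pt d) (hx : x ∈ cube d)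
    (h0 : ∀ l, x l = 0 → α l = 0) (h1 : ∀ l, x l = 1 → 0 ≤ α l) :
    ENNReal.ofReal (∑ l, α l * v l - hamiltonian P p i x α) ≤ reflectedLagrangian P p i x v := by
  unfold reflectedLagrangian
  split_ifs
  · exact le_top
  · exact le_lagrangian x v α
  · refine le_iInf fun β => le_iInf fun n => le_iInf fun hβ => le_iInf fun hn => le_iInf fun _ =>
      le_trans (ENNReal.ofReal_le_ofReal (sub_le_sub_right ?_ _)) (le_lagrangian x (v + β • n) α)
    refine Finset.sum_le_sum fun l _ => ?_
    have hl : 0 ≤ α l * n l := by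
      rcases eq_or_ne (x l) 0 with hx0 | hx0
      · rw [h0 l hx0, zero_mul]
      rcases eq_or_ne (x l) 1 with hx1 | hx1
      · exact mul_nonneg (h1 l hx1) ((hn.2 l).2.2 hx1)
      · rw [(hn.2 l).1 ⟨lt_of_le_of_ne (hx l).1 hx0.symm, lt_of_le_of_ne (hx l).2 hx1⟩, mul_zero]
    have : α l * (v + β • n) l = α l * v l + β * (α l * n l) := by
      simp only [PiLp.add_apply, PiLp.smul_apply, smul_eq_mul]; ring
    rw [this]
    linarith [mul_nonneg hβ hl]

/-- The hypotheses make `v` tangent to all active faces, so every normal is orthogonal to `v` and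
`q` is an allowed push, with `β = ‖q‖` and `n = q / ‖q‖`. If `q = 0` there may be no normal at all,
and the case of an interior point is separate. -/
lemma reflectedLagrangian_le {x v q : Pt d} (hx : x ∈ cube d) (hx1 : ∀ l, x l ≠ 1)
    (hv : ∀ l, x l = 0 → v l = 0) (hq0 : ∀ l, x l = 0 → q l ≤ 0) (hq : ∀ l, x l ≠ 0 → q l = 0) :
    reflectedLagrangian P p i x v ≤ lagrangian P p i x (v + q) := by
  have horth : ∀ n ∈ outwardNormals x, inner ℝ v n = 0 := by
    intro n hn
    rw [inner_eq_sum]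
    refine Finset.sum_eq_zero fun l _ => ?_
    rcases eq_or_ne (x l) 0 with hx0 | hx0
    · rw [hv l hx0, zero_mul]
    · rw [(hn.2 l).1 ⟨lt_of_le_of_ne (hx l).1 hx0.symm, lt_of_le_of_ne (hx l).2 (hx1 l)⟩, mul_zero]
  unfold reflectedLagrangian
  rw [if_neg (by rintro ⟨n, hn, hpos⟩; exact hpos.ne' (horth n hn))]
  by_cases hq' : q = 0
  · subst hq'
    rw [add_zero]
    split_ifs with h
    · exact le_rfl
    · push Not at h
      obtain ⟨n, hn, -⟩ := h
      refine iInf_le_of_le 0 (iInf_le_of_le n (iInf_le_of_le le_rfl (iInf_le_of_le hn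
        (iInf_le_of_le ?_ ?_))))
      · rw [real_inner_comm]; exact horth n hn
      · rw [zero_smul, add_zero]
  · have hn : ‖q‖⁻¹ • q ∈ outwardNormals x := by
      refine ⟨by rw [norm_smul, norm_inv, norm_norm, inv_mul_cancel₀ (norm_ne_zero_iff.2 hq')],
        fun l => ⟨fun h => ?_, fun h => ?_, fun h => absurd h (hx1 l)⟩⟩
      · simp [hq l h.1.ne']
      · simpa using mul_nonpos_of_nonneg_of_nonpos (inv_nonneg.2 (norm_nonneg q)) (hq0 l h)
    rw [if_neg (fun h => (h _ hn).ne (horth _ hn))]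
    refine iInf_le_of_le ‖q‖ (iInf_le_of_le (‖q‖⁻¹ • q) (iInf_le_of_le (norm_nonneg _)
      (iInf_le_of_le hn (iInf_le_of_le ?_ ?_))))
    · rw [real_inner_comm]; exact horth _ hn
    · rw [smul_smul, mul_inv_cancel₀ (norm_ne_zero_iff.2 hq'), one_smul]

end Environment

/-- The momentum along the optimal path: the gradient of the potential, put to `0` in the
coordinates in which `x` is at the lower boundary. -/
def optimalMomentum (g : Fin 2 → ℝ → ℝ) (x : Pt 2) (l : Fin 2) : ℝ :=
  if x l = 0 then 0 else 2 * Real.artanh (g l (x l))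

namespace TwoStacksModel

variable {P : Matrix (Fin 2) (Fin 2) ℝ} {μ lam : Fin 2 → ℝ} {g : Fin 2 → ℝ → ℝ}

lemma optimalMomentum_nonneg (M : TwoStacksModel P μ lam g) {x : Pt 2} (hx : x ∈ cube 2)
    (l : Fin 2) : 0 ≤ optimalMomentum g x l := by
  unfold optimalMomentum
  split_ifs
  · exact le_rfl
  · exact mul_nonneg zero_le_two (Real.artanh_nonneg (M.mem_Ico l _ (hx l)).1)

lemma hamiltonian_zero_le (M : TwoStacksModel P μ lam g) (i : Fin 2) {x : Pt 2} (hx : x ∈ cube 2) :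
    hamiltonian P (twoStacks lam g) i x 0 ≤ 0 := by
  obtain ⟨C, -, κ, hκ, h⟩ := M.exists_hamiltonian_single_le i 0
  have h0 : (EuclideanSpace.single 0 0 : Pt 2) = 0 := by ext; simp
  simpa [h0] using h x hx 0 (by simpa using hκ.le)

/-- The momentum arises from `0` by reflecting the coordinates off the lower faces, so its
Hamiltonian is that of `0`: this is the Hamilton–Jacobi equation for the potential, used as a
subsolution. -/
lemma sum_optimalMomentum_le_lagrangian (M : TwoStacksModel P μ lam g) (i : Fin 2) {x : Pt 2}
    (hx : x ∈ cube 2) (v : Pt 2) :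
    ENNReal.ofReal (∑ l, optimalMomentum g x l * v l) ≤ lagrangian P (twoStacks lam g) i x v := by
  refine le_trans (ENNReal.ofReal_le_ofReal ?_)
    (le_lagrangian x v (WithLp.toLp 2 (optimalMomentum g x)))
  have := (M.hamiltonian_reflect hx i (α := WithLp.toLp 2 (optimalMomentum g x)) (β := 0)
    fun l => by
      simp only [optimalMomentum]
      split_ifs <;> simp).trans_le (M.hamiltonian_zero_le i hx)
  simp only
  linarith

lemma sum_optimalMomentum_le_reflectedLagrangian (M : TwoStacksModel P μ lam g) (i : Fin 2)
    {x : Pt 2} (hx : x ∈ cube 2) (v : Pt 2) :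
    ENNReal.ofReal (∑ l, optimalMomentum g x l * v l) ≤
      reflectedLagrangian P (twoStacks lam g) i x v := by
  refine le_trans (ENNReal.ofReal_le_ofReal ?_)
    (le_reflectedLagrangian (α := WithLp.toLp 2 (optimalMomentum g x)) v hx
      (fun l h => by simp [optimalMomentum, h]) (fun l _ => M.optimalMomentum_nonneg hx l))
  have := (M.hamiltonian_reflect hx i (α := WithLp.toLp 2 (optimalMomentum g x)) (β := 0)
    fun l => by
      simp only [optimalMomentum]
      split_ifs <;> simp).trans_le (M.hamiltonian_zero_le i hx)
  simp only
  linarith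

/-- A quantitative form of the lower bound: velocities other than the optimal one cost more. -/
lemma exists_excess_le_reflectedLagrangian (M : TwoStacksModel P μ lam g) (i l : Fin 2) :
    ∃ C ≥ 0, ∃ κ > 0, ∀ x ∈ cube 2, x l ≠ 0 → ∀ (v : Pt 2) (a : ℝ), |a| ≤ κ →
      ENNReal.ofReal (∑ l, optimalMomentum g x l * v l +
        (a * (v l - speed μ lam l * g l (x l)) - C * a ^ 2)) ≤
        reflectedLagrangian P (twoStacks lam g) i x v := by
  obtain ⟨C, hC, κ, hκ, h⟩ := M.exists_hamiltonian_single_le i l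
  have hθ : 0 < 2 * Real.artanh (g l 1) := mul_pos two_pos (Real.artanh_pos
    ⟨M.pos l 1 (right_mem_Ioc.2 zero_lt_one), (M.mem_Ico l 1 (right_mem_Icc.2 zero_le_one)).2⟩)
  -- The dual vector tried is the optimal momentum plus `a e_l`. The second bound on `|a|` keeps its
  -- component nonnegative on the face `x l = 1`; on the face `x l = 0` it would not be admissible,
  -- hence the restriction on `x`.
  refine ⟨C, hC, min κ (2 * Real.artanh (g l 1)), lt_min hκ hθ, fun x hx hxl v a ha => ?_⟩
  set α : Pt 2 := WithLp.toLp 2 (optimalMomentum g x) + EuclideanSpace.single l a with hα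
  have hα' : ∀ k, α k = optimalMomentum g x k + if k = l then a else 0 := by
    intro k
    rw [hα]
    simp
  refine le_trans (ENNReal.ofReal_le_ofReal ?_) (le_reflectedLagrangian (α := α) v hx
    (fun k hk => ?_) (fun k hk => ?_))
  -- Reflection sends this vector to `-a e_l`, where the second-order bound applies.
  · have h1 := M.hamiltonian_reflect hx i (α := α) (β := EuclideanSpace.single l (-a))
      (fun k => by
        rw [hα', optimalMomentum]
        rcases eq_or_ne k l with rfl | hkl
        · rw [if_neg hxl]; simp
        · simp only [hkl, if_false, add_zero]
          split_ifs <;> simp [hkl])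
    have h2 := h x hx (-a) (by rw [abs_neg]; exact ha.trans (min_le_left _ _))
    have h3 : ∑ k, α k * v k = ∑ k, optimalMomentum g x k * v k + a * v l := by
      simp only [hα', add_mul, Finset.sum_add_distrib, ite_mul, zero_mul, Finset.sum_ite_eq',
        Finset.mem_univ, if_true]
    rw [h1, h3]
    rw [neg_sq] at h2
    linarith
  · have hkl : k ≠ l := fun h => hxl (h ▸ hk)
    rw [hα', optimalMomentum, if_pos hk, if_neg hkl, add_zero]
  · rw [hα']
    split_ifs with hkl
    · subst hkl
      rw [optimalMomentum, if_neg hxl, hk]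
      linarith [(abs_le.1 (ha.trans (min_le_right _ _))).1]
    · simpa using M.optimalMomentum_nonneg hx k

/-- The velocity reversing the averaged drift is optimal. -/
lemma lagrangian_reversed_le (M : TwoStacksModel P μ lam g) (i : Fin 2) {x w : Pt 2}
    (hx : x ∈ cube 2)
    (hw : ∀ l, w l = if x l = 0 then -(speed μ lam l * g l (x l)) else speed μ lam l * g l (x l)) :
    lagrangian P (twoStacks lam g) i x w ≤
      ENNReal.ofReal (∑ l, optimalMomentum g x l * (speed μ lam l * g l (x l))) := by
  refine iSup_le fun α => ENNReal.ofReal_le_ofReal ?_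
  -- The tangent bound at the reflected point `β` bounds the Hamiltonian at `α`, and the terms in
  -- `α` cancel coordinate by coordinate against `⟨α, w⟩`.
  set β : Pt 2 := WithLp.toLp 2
    (fun l => if x l = 0 then α l else 2 * Real.artanh (g l (x l)) - α l) with hβ
  have h1 := M.hamiltonian_reflect hx i (α := β) (β := α) (fun l => by
    simp only [hβ]
    split_ifs <;> simp)
  have h2 := M.sum_mul_drift_le_hamiltonian hx i β
  rw [← h1, inner_eq_sum]
  refine (sub_le_sub_left h2 _).trans (le_of_eq ?_)
  rw [← Finset.sum_sub_distrib]
  refine Finset.sum_congr rfl fun l _ => ?_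
  simp only [hw, hβ, optimalMomentum]
  split_ifs <;> ring

/-- Coercivity with slope `1` in the maximum norm makes all velocities in the dual unit ball
affordable; this pays for the straight line leaving `0`. -/
lemma exists_lagrangian_le (M : TwoStacksModel P μ lam g) (i : Fin 2) :
    ∃ K : ℝ, ∀ x ∈ cube 2, ∀ v : Pt 2, ∑ l, |v l| ≤ 1 →
      lagrangian P (twoStacks lam g) i x v ≤ ENNReal.ofReal K := by
  obtain ⟨K, hK⟩ := M.exists_abs_sub_le_hamiltonian i
  refine ⟨K, fun x hx v hv => iSup_le fun α => ENNReal.ofReal_le_ofReal ?_⟩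
  obtain ⟨l, -, hl⟩ := Finset.exists_max_image Finset.univ (fun l => |α l|) Finset.univ_nonempty
  have h1 : inner ℝ α v ≤ |α l| := by
    rw [inner_eq_sum]
    calc ∑ k, α k * v k ≤ ∑ k, |α l| * |v k| := Finset.sum_le_sum fun k _ => by
          refine (le_abs_self _).trans ?_
          rw [abs_mul]
          exact mul_le_mul_of_nonneg_right (hl k (Finset.mem_univ k)) (abs_nonneg _)
      _ = |α l| * ∑ k, |v k| := by rw [Finset.mul_sum]
      _ ≤ |α l| := mul_le_of_le_one_right (abs_nonneg _) hv
  linarith [hK x hx α l]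

end TwoStacksModel

/-! ### Absolutely continuous paths -/

section AbsolutelyContinuous

variable {X Y : Type*} [PseudoMetricSpace X] [PseudoMetricSpace Y] {a b : ℝ}

lemma absolutelyContinuousOnInterval_of_dist_le {f : ℝ → X} {F : ℝ → Y}
    (hF : AbsolutelyContinuousOnInterval F a b) {K : ℝ}
    (h : ∀ s ∈ uIcc a b, ∀ t ∈ uIcc a b, dist (f s) (f t) ≤ K * dist (F s) (F t)) :
    AbsolutelyContinuousOnInterval f a b := by
  unfold AbsolutelyContinuousOnInterval at hF ⊢
  have hK : Tendsto (fun E : ℕ × (ℕ → ℝ × ℝ) => K *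
      ∑ i ∈ Finset.range E.1, dist (F (E.2 i).1) (F (E.2 i).2))
      (AbsolutelyContinuousOnInterval.totalLengthFilter ⊓
        𝓟 (AbsolutelyContinuousOnInterval.disjWithin a b)) (𝓝 0) := by
    simpa using hF.const_mul K
  refine squeeze_zero' (Eventually.of_forall fun E => Finset.sum_nonneg fun _ _ => dist_nonneg)
    ?_ hK
  filter_upwards [mem_inf_of_right (mem_principal_self _)] with E hE
  rw [Finset.mul_sum]
  exact Finset.sum_le_sum fun i hi => h _ (hE.1 i hi).1 _ (hE.1 i hi).2

lemma _root_.AbsolutelyContinuousOnInterval.congr {f F : ℝ → X}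
    (hF : AbsolutelyContinuousOnInterval F a b) (h : EqOn f F (uIcc a b)) :
    AbsolutelyContinuousOnInterval f a b :=
  absolutelyContinuousOnInterval_of_dist_le hF (K := 1)
    fun s hs t ht => by rw [h hs, h ht, one_mul]

lemma _root_.AbsolutelyContinuousOnInterval.lipschitz_comp {F : ℝ → X}
    (hF : AbsolutelyContinuousOnInterval F a b) {h : X → Y} {K : NNReal} (hh : LipschitzWith K h) :
    AbsolutelyContinuousOnInterval (fun t => h (F t)) a b :=
  absolutelyContinuousOnInterval_of_dist_le hF (K := K) fun _ _ _ _ => hh.dist_le_mul _ _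

lemma lipschitzWith_coord {d : ℕ} (l : Fin d) : LipschitzWith 1 (fun x : Pt d => x l) :=
  LipschitzWith.of_dist_le_mul fun x y => by
    rw [NNReal.coe_one, one_mul, dist_eq_norm, dist_eq_norm]
    simpa using PiLp.norm_apply_le (x - y) l

lemma _root_.AbsolutelyContinuousOnInterval.coord {d : ℕ} {F : ℝ → Pt d}
    (hF : AbsolutelyContinuousOnInterval F a b) (l : Fin d) :
    AbsolutelyContinuousOnInterval (fun t => F t l) a b :=
  AbsolutelyContinuousOnInterval.lipschitz_comp hF (lipschitzWith_coord l)

/-- Changing variables in the fundamental theorem of calculus exhibits the reversed function as a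
constant minus a primitive of an integrable function. -/
lemma _root_.AbsolutelyContinuousOnInterval.comp_neg {f : ℝ → ℝ}
    (hf : AbsolutelyContinuousOnInterval f (-b) (-a)) :
    AbsolutelyContinuousOnInterval (fun t => f (-t)) a b := by
  have hinteg : IntervalIntegrable (fun t => deriv f (-t)) volume a b := by
    have := (IntervalIntegrable.iff_comp_neg (by simp)).1 hf.intervalIntegrable_deriv
    simpa using this.symm
  have h1 := (hinteg.absolutelyContinuousOnInterval_intervalIntegral (c := a) left_mem_uIcc).neg
  refine absolutelyContinuousOnInterval_of_dist_le h1 (K := 1) fun s hs t ht => le_of_eq ?_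
  have key : ∀ t ∈ uIcc a b, f (-t) = f (-a) + (-(fun x => ∫ v in a..x, deriv f (-v))) t := by
    intro t ht
    rw [Pi.neg_apply, intervalIntegral.integral_comp_neg (fun v => deriv f v),
      (hf.mono (c := -t) (d := -a) ?_).integral_deriv_eq_sub]
    · ring
    · refine uIcc_subset_uIcc ?_ right_mem_uIcc
      rw [mem_uIcc] at ht ⊢
      rcases ht with ⟨h1, h2⟩ | ⟨h1, h2⟩
      · left; constructor <;> linarith
      · right; constructor <;> linarith
  simp only [key s hs, key t ht, dist_add_left, one_mul]

lemma deriv_coord {d : ℕ} {F : ℝ → Pt d} {t : ℝ} (hF : DifferentiableAt ℝ F t) (l : Fin d) :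
    HasDerivAt (fun t => F t l) (deriv F t l) t :=
  (EuclideanSpace.proj (𝕜 := ℝ) l).hasFDerivAt.comp_hasDerivAt t hF.hasDerivAt

lemma _root_.AbsolutelyContinuousOnInterval.ae_differentiableAt_pt {d : ℕ} {F : ℝ → Pt d}
    (hF : AbsolutelyContinuousOnInterval F a b) :
    ∀ᵐ t, t ∈ uIcc a b → DifferentiableAt ℝ F t :=
  hF.boundedVariationOn.ae_differentiableAt_of_mem_uIcc

end AbsolutelyContinuous

lemma ofReal_integral_le_lintegral {α : Type*} [MeasurableSpace α] {ν : Measure α} {f : α → ℝ}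
    (hf : Integrable f ν) : ENNReal.ofReal (∫ t, f t ∂ν) ≤ ∫⁻ t, ENNReal.ofReal (f t) ∂ν := by
  rw [integral_eq_lintegral_pos_part_sub_lintegral_neg_part hf]
  exact (ENNReal.ofReal_le_ofReal (sub_le_self _ ENNReal.toReal_nonneg)).trans
    ENNReal.ofReal_toReal_le

/-- If a continuous function can increase by at most `∫ w` on the intervals in which it stays above
its initial value, it can increase by at most `∫ w` altogether. -/
lemma sub_le_integral_of_excursions {f w : ℝ → ℝ} {s t : ℝ} (hst : s ≤ t)
    (hf : ContinuousOn f (Icc s t)) (hw : IntervalIntegrable w volume s t) (hw0 : ∀ r, 0 ≤ w r)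
    (h : ∀ u ∈ Icc s t, (∀ r ∈ Ioc u t, f s < f r) → f t - f u ≤ ∫ r in u..t, w r) :
    f t - f s ≤ ∫ r in s..t, w r := by
  set A := Icc s t ∩ f ⁻¹' Iic (f s) with hA
  have hAc : IsCompact A := by
    refine isCompact_Icc.of_isClosed_subset ?_ inter_subset_left
    exact hf.preimage_isClosed_of_isClosed isClosed_Icc isClosed_Iic
  have hAn : A.Nonempty := ⟨s, left_mem_Icc.2 hst, le_refl (f s)⟩
  obtain ⟨hu, hu'⟩ := hAc.sSup_mem hAn
  -- The time `u` is the last one at which `f` does not exceed `f s`; after it `f` is on an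
  -- excursion above `f s`.
  set u := sSup A
  have h1 := h u hu fun r hr => by
    by_contra! hle
    exact absurd (le_csSup hAc.bddAbove ⟨⟨hu.1.trans hr.1.le, hr.2⟩, hle⟩) (not_le.2 hr.1)
  have h2 : ∫ r in u..t, w r ≤ ∫ r in s..t, w r := by
    have hi1 : IntervalIntegrable w volume s u :=
      hw.mono_set (uIcc_subset_uIcc left_mem_uIcc (by rw [uIcc_of_le hst]; exact hu))
    have hi2 : IntervalIntegrable w volume u t :=
      hw.mono_set (uIcc_subset_uIcc (by rw [uIcc_of_le hst]; exact hu) right_mem_uIcc)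
    rw [← intervalIntegral.integral_add_adjacent_intervals hi1 hi2]
    linarith [intervalIntegral.integral_nonneg (μ := volume) hu.1 (fun r _ => hw0 r)]
  have h3 : f u ≤ f s := hu'
  linarith

/-! ### The Skorokhod problem in the cube, coordinate by coordinate -/

section Skorokhod

variable {d : ℕ} {T : ℝ} {w x : ℝ → Pt d}

lemma IsReflection.exists_density (h : IsReflection T w x) :
    ∃ (ν : Measure ℝ) (n : ℝ → Pt d), IsFiniteMeasure ν ∧
      (∀ᵐ s ∂(ν.restrict (Ioc 0 T)), n s ∈ outwardNormals (x s)) ∧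
      ∀ l, ∀ s t, 0 ≤ s → s ≤ t → t ≤ T →
        w t l - x t l - (w s l - x s l) = ∫ r in Ioc s t, n r l ∂ν := by
  obtain ⟨-, -, -, ν, n, hν, hn, hnorm, heq⟩ := h
  refine ⟨ν, n, hν, hnorm, fun l s t hs hst ht => ?_⟩
  have hinteg : IntegrableOn n (Ioc 0 T) ν := by
    refine Integrable.of_bound hn.aestronglyMeasurable 1 ?_
    filter_upwards [hnorm] with r hr using hr.1.le
  have hst' : IntegrableOn n (Ioc s t) ν := hinteg.mono_set (Ioc_subset_Ioc hs ht)
  have e1 := heq t ⟨hs.trans hst, ht⟩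
  have e2 := heq s ⟨hs, hst.trans ht⟩
  have e3 : ∫ r in Ioc 0 t, n r ∂ν = ∫ r in Ioc 0 s, n r ∂ν + ∫ r in Ioc s t, n r ∂ν := by
    rw [← Ioc_union_Ioc_eq_Ioc hs hst, setIntegral_union (Ioc_disjoint_Ioc_of_le le_rfl)
      measurableSet_Ioc (hinteg.mono_set (Ioc_subset_Ioc_right (hst.trans ht))) hst']
  have e4 : w t - x t - (w s - x s) = ∫ r in Ioc s t, n r ∂ν := by rw [e1, e2, e3]; abel
  have e5 := congrArg (EuclideanSpace.proj (𝕜 := ℝ) l) e4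
  rw [← ContinuousLinearMap.integral_comp_comm _ hst'] at e5
  simpa using e5

/-- Away from the face `x l = 0`, the `l`-th component of an outward normal is nonnegative. The left
end `s` is exempt since the push is integrated over `(s,t]`, which lets excursions start on the
face. -/
lemma IsReflection.push_mono (h : IsReflection T w x) {l : Fin d} {s t : ℝ} (hs : 0 ≤ s)
    (hst : s ≤ t) (ht : t ≤ T) (hpos : ∀ r ∈ Ioc s t, 0 < x r l) :
    w s l - x s l ≤ w t l - x t l := by
  obtain ⟨ν, n, hν, hn, heq⟩ := h.exists_density
  rw [← sub_nonneg, heq l s t hs hst ht]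
  refine setIntegral_nonneg_of_ae_restrict ?_
  have hsub : Ioc s t ⊆ Ioc 0 T := Ioc_subset_Ioc hs ht
  filter_upwards [ae_restrict_of_ae_restrict_of_subset hsub hn, ae_restrict_mem measurableSet_Ioc]
    with r hr hmem
  rcases eq_or_lt_of_le (h.2.2.1 r (Ioc_subset_Icc_self (hsub hmem)) l).2 with h1 | h1
  · exact (hr.2 l).2.2 h1
  · exact ((hr.2 l).1 ⟨hpos r hmem, h1⟩).ge

lemma IsReflection.push_anti (h : IsReflection T w x) {l : Fin d} {s t : ℝ} (hs : 0 ≤ s)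
    (hst : s ≤ t) (ht : t ≤ T) (hlt : ∀ r ∈ Ioc s t, x r l < 1) :
    w t l - x t l ≤ w s l - x s l := by
  obtain ⟨ν, n, hν, hn, heq⟩ := h.exists_density
  rw [← sub_nonpos, heq l s t hs hst ht]
  refine setIntegral_nonpos_of_ae_restrict ?_
  have hsub : Ioc s t ⊆ Ioc 0 T := Ioc_subset_Ioc hs ht
  filter_upwards [ae_restrict_of_ae_restrict_of_subset hsub hn, ae_restrict_mem measurableSet_Ioc]
    with r hr hmem
  rcases eq_or_lt_of_le (h.2.2.1 r (Ioc_subset_Icc_self (hsub hmem)) l).1 with h1 | h1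
  · exact (hr.2 l).2.1 h1.symm
  · exact ((hr.2 l).1 ⟨h1, hlt r hmem⟩).le

lemma IsReflection.apply_zero (h : IsReflection T w x) (hT : 0 ≤ T) : x 0 = w 0 := by
  obtain ⟨-, -, -, ν, n, -, -, -, heq⟩ := h
  have := heq 0 ⟨le_rfl, hT⟩
  rw [Ioc_self, Measure.restrict_empty, integral_zero_measure] at this
  exact (sub_eq_zero.1 this).symm

lemma IsReflection.continuousOn_coord (h : IsReflection T w x) (l : Fin d) :
    ContinuousOn (fun t => x t l) (Icc 0 T) :=
  (lipschitzWith_coord l).continuous.comp_continuousOn h.2.1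

/-- The reflection of an absolutely continuous path is absolutely continuous. -/
lemma IsReflection.absolutelyContinuous_coord (hT : 0 ≤ T) (h : IsReflection T w x) (l : Fin d)
    (hw : AbsolutelyContinuousOnInterval (fun t => w t l) 0 T) :
    AbsolutelyContinuousOnInterval (fun t => x t l) 0 T := by
  have hinteg : IntervalIntegrable (fun r => |deriv (fun t => w t l) r|) volume 0 T :=
    hw.intervalIntegrable_deriv.abs
  have hsub : ∀ u t, 0 ≤ u → u ≤ t → t ≤ T → uIcc u t ⊆ uIcc 0 T := fun u t h0 h1 h2 => by
    rw [uIcc_of_le h1, uIcc_of_le hT]; exact Icc_subset_Icc h0 h2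
  have hbd : ∀ u t, 0 ≤ u → u ≤ t → t ≤ T →
      |w t l - w u l| ≤ ∫ r in u..t, |deriv (fun t => w t l) r| := by
    intro u t h0 h1 h2
    have := (hw.mono (hsub u t h0 h1 h2)).integral_deriv_eq_sub
    rw [← this]
    exact intervalIntegral.abs_integral_le_integral_abs h1
  have key : ∀ s t, 0 ≤ s → s ≤ t → t ≤ T →
      |x s l - x t l| ≤ ∫ r in s..t, |deriv (fun t => w t l) r| := by
    intro s t h0 h1 h2
    have hc : ContinuousOn (fun t => x t l) (Icc s t) :=
      (h.continuousOn_coord l).mono (Icc_subset_Icc h0 h2)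
    have hi := hinteg.mono_set (hsub s t h0 h1 h2)
    rw [abs_le]
    constructor
    -- While the coordinate is above its initial value it is off the face `0`, so its push is
    -- nondecreasing and it rises no more than `w` does. Decreases are symmetric, with the face `1`.
    · have := sub_le_integral_of_excursions h1 hc hi (fun r => abs_nonneg _)
        (fun u hu hr => by
          have h3 := h.push_mono (h0.trans hu.1) hu.2 h2 (l := l) fun r hr' =>
            (h.2.2.1 s ⟨h0, h1.trans h2⟩ l).1.trans_lt (hr r hr')
          have h4 := (le_abs_self _).trans (hbd u t (h0.trans hu.1) hu.2 h2)
          linarith)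
      linarith
    · have := sub_le_integral_of_excursions (f := fun t => -x t l) h1 hc.neg hi (fun r => abs_nonneg _)
        (fun u hu hr => by
          have h3 := h.push_anti (h0.trans hu.1) hu.2 h2 (l := l) fun r hr' =>
            (neg_lt_neg_iff.1 (hr r hr')).trans_le (h.2.2.1 s ⟨h0, h1.trans h2⟩ l).2
          have h4 := (neg_le_abs _).trans (hbd u t (h0.trans hu.1) hu.2 h2)
          linarith)
      linarith
  have hAC := hinteg.absolutelyContinuousOnInterval_intervalIntegral (c := 0) left_mem_uIcc
  have hsplit : ∀ s t, 0 ≤ s → s ≤ t → t ≤ T → ∫ r in s..t, |deriv (fun t => w t l) r| =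
      (∫ r in (0 : ℝ)..t, |deriv (fun t => w t l) r|) -
        ∫ r in (0 : ℝ)..s, |deriv (fun t => w t l) r| := by
    intro s t h0 h1 h2
    rw [intervalIntegral.integral_interval_sub_left
      (hinteg.mono_set (hsub 0 t le_rfl (h0.trans h1) h2))
      (hinteg.mono_set (hsub 0 s le_rfl h0 (h1.trans h2)))]
  refine absolutelyContinuousOnInterval_of_dist_le hAC (K := 1) fun s hs t ht => ?_
  rw [uIcc_of_le hT] at hs ht
  rw [one_mul, Real.dist_eq, Real.dist_eq]
  rcases le_total s t with hst | hst
  · refine (key s t hs.1 hst ht.2).trans ?_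
    rw [hsplit s t hs.1 hst ht.2, abs_sub_comm]
    exact le_abs_self _
  · rw [abs_sub_comm]
    refine (key t s ht.1 hst hs.2).trans ?_
    rw [hsplit t s ht.1 hst hs.2]
    exact le_abs_self _

lemma IsReflection.deriv_push_nonneg (h : IsReflection T w x) {l : Fin d} {t : ℝ}
    (ht : t ∈ Ioo 0 T) (hpos : 0 < x t l) : 0 ≤ deriv (fun t => w t l - x t l) t := by
  have hc : ContinuousAt (fun t => x t l) t :=
    (h.continuousOn_coord l).continuousAt (Icc_mem_nhds ht.1 ht.2)
  obtain ⟨a, b, hab, hsub⟩ := mem_nhds_iff_exists_Ioo_subset.1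
    (inter_mem (Ioo_mem_nhds ht.1 ht.2) (hc.eventually (lt_mem_nhds hpos)))
  rw [← derivWithin_of_mem_nhds (Ioo_mem_nhds hab.1 hab.2)]
  refine MonotoneOn.derivWithin_nonneg fun s hs r hr hsr => ?_
  exact h.push_mono (hsub hs).1.1.le hsr (hsub hr).1.2.le fun u hu =>
    (hsub ⟨hs.1.trans hu.1, hu.2.trans_lt hr.2⟩).2

lemma IsReflection.deriv_push_nonpos (h : IsReflection T w x) {l : Fin d} {t : ℝ}
    (ht : t ∈ Ioo 0 T) (hlt : x t l < 1) : deriv (fun t => w t l - x t l) t ≤ 0 := by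
  have hc : ContinuousAt (fun t => x t l) t :=
    (h.continuousOn_coord l).continuousAt (Icc_mem_nhds ht.1 ht.2)
  obtain ⟨a, b, hab, hsub⟩ := mem_nhds_iff_exists_Ioo_subset.1
    (inter_mem (Ioo_mem_nhds ht.1 ht.2) (hc.eventually (gt_mem_nhds hlt)))
  rw [← derivWithin_of_mem_nhds (Ioo_mem_nhds hab.1 hab.2)]
  refine AntitoneOn.derivWithin_nonpos fun s hs r hr hsr => ?_
  exact h.push_anti (hsub hs).1.1.le hsr (hsub hr).1.2.le fun u hu =>
    (hsub ⟨hs.1.trans hu.1, hu.2.trans_lt hr.2⟩).2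

/-- A path pushed by an absolutely continuous term directed along the normals is a reflection. -/
lemma isReflection_of_density (hw : ContinuousOn w (Icc 0 T)) (hx : ContinuousOn x (Icc 0 T))
    (hcube : ∀ t ∈ Icc 0 T, x t ∈ cube d) {q : ℝ → Pt d} (hq : Measurable q) {B : ℝ}
    (hB : ∀ s, ‖q s‖ ≤ B)
    (hnormal : ∀ s ∈ Ioc 0 T, ∀ l, (x s l ∈ Ioo (0 : ℝ) 1 → q s l = 0) ∧
      (x s l = 0 → q s l ≤ 0) ∧ (x s l = 1 → 0 ≤ q s l))
    (heq : ∀ t ∈ Icc 0 T, w t - x t = ∫ s in Ioc 0 t, q s) : IsReflection T w x := by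
  have hqm : Measurable fun s => ‖q s‖₊ := hq.nnnorm
  -- Polar decomposition of `q`: mass `‖q‖ ds` and direction `q / ‖q‖`. Where `q = 0` the direction
  -- is not a unit vector, but the measure gives no mass to these times.
  refine ⟨hw, hx, hcube, (volume.restrict (Ioc 0 T)).withDensity fun s => (‖q s‖₊ : ENNReal),
    fun s => ‖q s‖⁻¹ • q s, ?_, hq.norm.inv.smul hq, ?_, fun t ht => ?_⟩
  · refine isFiniteMeasure_withDensity (ne_of_lt ?_)
    calc ∫⁻ s in Ioc 0 T, (‖q s‖₊ : ENNReal) ≤ ∫⁻ s in Ioc 0 T, ENNReal.ofReal B :=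
          lintegral_mono fun s => by
            rw [← enorm_eq_nnnorm, ← ofReal_norm]
            exact ENNReal.ofReal_le_ofReal (hB s)
      _ < ⊤ := by simp [ENNReal.mul_lt_top]
  · refine ae_restrict_of_ae ?_
    rw [ae_withDensity_iff hqm.coe_nnreal_ennreal]
    filter_upwards [ae_restrict_mem measurableSet_Ioc] with s hs hne
    have hne' : ‖q s‖ ≠ 0 := by simpa using hne
    refine ⟨by rw [norm_smul, norm_inv, norm_norm, inv_mul_cancel₀ hne'], fun l => ?_⟩
    obtain ⟨h1, h2, h3⟩ := hnormal s hs l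
    refine ⟨fun h => ?_, fun h => ?_, fun h => ?_⟩
    · simp [h1 h]
    · exact mul_nonpos_of_nonneg_of_nonpos (inv_nonneg.2 (norm_nonneg _)) (h2 h)
    · exact mul_nonneg (inv_nonneg.2 (norm_nonneg _)) (h3 h)
  · rw [heq t ht, restrict_withDensity measurableSet_Ioc,
      Measure.restrict_restrict measurableSet_Ioc,
      inter_eq_left.2 (Ioc_subset_Ioc_right ht.2), integral_withDensity_eq_integral_smul hqm]
    refine integral_congr_ae (Eventually.of_forall fun s => ?_)
    simp only [NNReal.smul_def, coe_nnnorm, smul_smul]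
    rcases eq_or_ne (q s) 0 with h | h
    · simp [h]
    · rw [mul_inv_cancel₀ (norm_ne_zero_iff.2 h), one_smul]

end Skorokhod

/-! ### The scalar descent equation -/

lemma ae_Ioc_of_ae_Ioo {a b : ℝ} {p : ℝ → Prop} (h : ∀ᵐ t, t ∈ Ioo a b → p t) :
    ∀ᵐ t, t ∈ Ioc a b → p t := by
  have hne : ∀ᵐ t : ℝ, t ≠ b := by simp [ae_iff, measure_singleton]
  filter_upwards [h, hne] with t ht htb hmem
  exact ht ⟨hmem.1, lt_of_le_of_ne hmem.2 htb⟩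

/-- On `[0,T]`, the path `u` goes down with speed `b u` until it reaches `0`, where it stays. -/
structure IsDescentOn (b : ℝ → ℝ) (T : ℝ) (u : ℝ → ℝ) : Prop where
  ac : AbsolutelyContinuousOnInterval u 0 T
  mem : ∀ t ∈ Icc 0 T, u t ∈ Icc (0 : ℝ) 1
  deriv_eq : ∀ᵐ t, t ∈ Ioo 0 T → deriv u t = if u t = 0 then 0 else -b (u t)

namespace IsDescentOn

variable {b u v : ℝ → ℝ} {T : ℝ}

lemma mono (hu : IsDescentOn b T u) {S : ℝ} (hS : 0 ≤ S) (hST : S ≤ T) : IsDescentOn b S u where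
  ac := hu.ac.mono (by
    rw [uIcc_of_le hS, uIcc_of_le (hS.trans hST)]; exact Icc_subset_Icc_right hST)
  mem t ht := hu.mem t ⟨ht.1, ht.2.trans hST⟩
  deriv_eq := by
    filter_upwards [hu.deriv_eq] with t ht hmem using ht ⟨hmem.1, hmem.2.trans_le hST⟩

lemma congr (hT : 0 ≤ T) (hu : IsDescentOn b T u) (h : EqOn v u (Icc 0 T)) :
    IsDescentOn b T v where
  ac := hu.ac.congr (by rwa [uIcc_of_le hT])
  mem t ht := by rw [h ht]; exact hu.mem t ht
  deriv_eq := by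
    filter_upwards [hu.deriv_eq] with t ht hmem
    have he : v =ᶠ[𝓝 t] u := h.eventuallyEq_of_mem (Icc_mem_nhds hmem.1 hmem.2)
    rw [he.deriv_eq, ht hmem, h (Ioo_subset_Icc_self hmem)]

/-- The velocity field jumps at `0`, but in the favourable direction: it is one-sided Lipschitz, `(u
- v) (u' - v') ≤ K (u - v)²`, so `exp (-2Kt) (u - v)²` is nonincreasing. -/
lemma eqOn {K : NNReal} (hb : LipschitzWith K b) (hb0 : ∀ z, 0 ≤ b z)
    (hu : IsDescentOn b T u) (hv : IsDescentOn b T v) (h0 : u 0 = v 0) : EqOn u v (Icc 0 T) := by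
  intro t₁ ht₁
  replace hu := hu.mono ht₁.1 ht₁.2
  replace hv := hv.mono ht₁.1 ht₁.2
  set e : ℝ → ℝ := fun t => Real.exp (-(2 * K) * t)
  have hecd : ContDiff ℝ 1 e := by fun_prop
  have heAC : AbsolutelyContinuousOnInterval e 0 t₁ :=
    hecd.contDiffOn.absolutelyContinuousOnInterval
  have hD := heAC.mul ((hu.ac.sub hv.ac).mul (hu.ac.sub hv.ac))
  have hinteg := hD.integral_deriv_eq_sub
  have hneg : ∫ t in (0 : ℝ)..t₁, deriv (e * ((u - v) * (u - v))) t ≤ 0 := by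
    rw [intervalIntegral.integral_of_le ht₁.1]
    refine setIntegral_nonpos_of_ae_restrict ?_
    rw [EventuallyLE, ae_restrict_iff' measurableSet_Ioc]
    refine ae_Ioc_of_ae_Ioo ?_
    filter_upwards [hu.ac.ae_differentiableAt, hv.ac.ae_differentiableAt, hu.deriv_eq,
      hv.deriv_eq] with t h1 h2 h3 h4 hmem
    have hm' : t ∈ uIcc 0 t₁ := by rw [uIcc_of_le ht₁.1]; exact Ioo_subset_Icc_self hmem
    have hd1 := (h1 hm').hasDerivAt
    have hd2 := (h2 hm').hasDerivAt
    have hde : HasDerivAt e (Real.exp (-(2 * K) * t) * (-(2 * K))) t := by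
      have := ((hasDerivAt_id t).const_mul (-(2 * (K : ℝ)))).exp
      rw [mul_one] at this
      exact this
    have hd := hde.mul ((hd1.sub hd2).mul (hd1.sub hd2))
    rw [hd.deriv, h3 hmem, h4 hmem]
    have hmu := hu.mem t (Ioo_subset_Icc_self hmem)
    have hmv := hv.mem t (Ioo_subset_Icc_self hmem)
    have hbu := hb0 (u t)
    have hbv := hb0 (v t)
    have hK : (0 : ℝ) ≤ K * (u t - v t) ^ 2 := by positivity
    have key : (u t - v t) * ((if u t = 0 then 0 else -b (u t)) - if v t = 0 then 0 else -b (v t)) ≤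
        K * (u t - v t) ^ 2 := by
      split_ifs with c1 c2 c2
      · simpa using hK
      · rw [c1] at hK ⊢
        nlinarith [hmv.1]
      · rw [c2] at hK ⊢
        nlinarith [hmu.1]
      · have hl := hb.dist_le_mul (v t) (u t)
        rw [Real.dist_eq, Real.dist_eq] at hl
        calc (u t - v t) * (-b (u t) - -b (v t)) ≤ |(u t - v t) * (-b (u t) - -b (v t))| :=
              le_abs_self _
          _ = |u t - v t| * |b (v t) - b (u t)| := by rw [abs_mul]; ring_nf
          _ ≤ |u t - v t| * (K * |v t - u t|) := mul_le_mul_of_nonneg_left hl (abs_nonneg _)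
          _ = K * (u t - v t) ^ 2 := by rw [abs_sub_comm (v t), ← sq_abs (u t - v t)]; ring
    have hexp : 0 ≤ e t := (Real.exp_pos _).le
    simp only [Pi.zero_apply, Pi.mul_apply, Pi.sub_apply]
    change e t * (-(2 * K)) * _ + e t * _ ≤ 0
    nlinarith [mul_le_mul_of_nonneg_left key hexp]
  rw [hinteg] at hneg
  simp only [Pi.mul_apply, Pi.sub_apply, h0, sub_self, mul_zero, sub_zero] at hneg
  have hsq : (u t₁ - v t₁) * (u t₁ - v t₁) ≤ 0 :=
    nonpos_of_mul_nonpos_right hneg (Real.exp_pos _)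
  have := mul_self_eq_zero.1 (le_antisymm hsq (mul_self_nonneg _))
  linarith

lemma sub_eq_integral (hu : IsDescentOn b T u) {s t : ℝ} (hs : 0 ≤ s) (hst : s ≤ t) (ht : t ≤ T) :
    u t - u s = ∫ r in s..t, deriv u r :=
  (hu.ac.mono (by
    rw [uIcc_of_le hst, uIcc_of_le (hs.trans (hst.trans ht))]
    exact Icc_subset_Icc hs ht)).integral_deriv_eq_sub.symm

lemma sub_le (hu : IsDescentOn b T u) {s t m : ℝ} (hs : 0 ≤ s) (hst : s ≤ t) (ht : t ≤ T)
    (hm : ∀ r ∈ Ioo s t, (if u r = 0 then 0 else -b (u r)) ≤ -m) : u t - u s ≤ -m * (t - s) := by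
  rw [hu.sub_eq_integral hs hst ht]
  have hi := (hu.ac.mono (c := s) (d := t) (by
    rw [uIcc_of_le hst, uIcc_of_le (hs.trans (hst.trans ht))]
    exact Icc_subset_Icc hs ht)).intervalIntegrable_deriv
  have hc : ∫ _ in s..t, (-m) = -m * (t - s) := by
    rw [intervalIntegral.integral_const, smul_eq_mul, mul_comm]
  rw [← hc]
  refine intervalIntegral.integral_mono_ae_restrict hst hi intervalIntegrable_const ?_
  rw [EventuallyLE, ae_restrict_iff' measurableSet_Icc]
  have hne : ∀ᵐ t : ℝ, t ≠ s := by simp [ae_iff, measure_singleton]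
  have h1 : ∀ᵐ r, r ∈ Ioc s t → deriv u r ≤ -m := by
    refine ae_Ioc_of_ae_Ioo ?_
    filter_upwards [hu.deriv_eq] with r hr hmem
    rw [hr ⟨hs.trans_lt hmem.1, hmem.2.trans_le ht⟩]
    exact hm r hmem
  filter_upwards [h1, hne] with r hr hrs hmem
  exact hr ⟨lt_of_le_of_ne hmem.1 hrs.symm, hmem.2⟩

lemma antitone (hu : IsDescentOn b T u) (hb0 : ∀ z, 0 ≤ b z) {s t : ℝ} (hs : 0 ≤ s) (hst : s ≤ t)
    (ht : t ≤ T) : u t ≤ u s := by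
  have := hu.sub_le hs hst ht (m := 0) fun r _ => by
    split_ifs
    · simp
    · simpa using hb0 (u r)
  linarith

lemma abs_sub_le (hu : IsDescentOn b T u) {L : ℝ} (hbL : ∀ z, |b z| ≤ L) {s t : ℝ} (hs : 0 ≤ s)
    (hst : s ≤ t) (ht : t ≤ T) : |u t - u s| ≤ L * |t - s| := by
  rw [hu.sub_eq_integral hs hst ht]
  refine intervalIntegral.norm_integral_le_of_norm_le_const_ae (f := deriv u) ?_
  rw [uIoc_of_le hst]
  refine ae_Ioc_of_ae_Ioo ?_
  filter_upwards [hu.deriv_eq] with r hr hmem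
  rw [hr ⟨hs.trans_lt hmem.1, hmem.2.trans_le ht⟩]
  split_ifs
  · simpa using (abs_nonneg _).trans (hbL 0)
  · simpa using hbL (u r)

lemma tendsto_zero (hu : ∀ T, 0 ≤ T → IsDescentOn b T u) (hb : Continuous b) (hb0 : ∀ z, 0 ≤ b z)
    (hpos : ∀ z ∈ Ioc (0 : ℝ) 1, 0 < b z) : Tendsto u atTop (𝓝 0) := by
  have hmem : ∀ t, 0 ≤ t → u t ∈ Icc (0 : ℝ) 1 := fun t ht => (hu t ht).mem t ⟨ht, le_rfl⟩
  have key : ∀ ε > 0, ∃ t, 0 ≤ t ∧ u t < ε := by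
    intro ε hε
    by_contra! hge
    have hε1 : ε ≤ 1 := (hge 0 le_rfl).trans (hmem 0 le_rfl).2
    obtain ⟨z, hz, hmin⟩ := isCompact_Icc.exists_isMinOn (nonempty_Icc.2 hε1) hb.continuousOn
    have hm : 0 < b z := hpos z ⟨hε.trans_le hz.1, hz.2⟩
    -- Staying above `ε` for the time `2 / b z` at speed at least `b z` would mean a fall by `2`
    -- inside `[0,1]`.
    have hT : 0 ≤ 2 / b z := by positivity
    have := (hu _ hT).sub_le le_rfl hT le_rfl (m := b z) fun r hr => by
      have h1 := hge r hr.1.le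
      rw [if_neg (hε.trans_le h1).ne', neg_le_neg_iff]
      exact hmin ⟨h1, (hmem r hr.1.le).2⟩
    have h2 : -b z * (2 / b z - 0) = -2 := by field_simp; ring
    rw [h2] at this
    linarith [(hmem 0 le_rfl).2, (hmem _ hT).1]
  rw [Metric.tendsto_atTop]
  intro ε hε
  obtain ⟨t, ht, hlt⟩ := key ε hε
  refine ⟨t, fun s hs => ?_⟩
  have h1 := (hu s (ht.trans hs)).antitone hb0 ht hs le_rfl
  rw [Real.dist_eq, sub_zero, abs_of_nonneg (hmem s (ht.trans hs)).1]
  linarith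

end IsDescentOn

/-- In one dimension, truncation does the work of reflection: solve `y' = -b(y)` freely and take
`max y 0`. Where this is `0` it is at a minimum, so its derivative is `0`. -/
lemma exists_isDescentOn {b : ℝ → ℝ} {K : NNReal} (hb : LipschitzWith K b) (hb0 : ∀ z, 0 ≤ b z)
    {L : NNReal} (hbL : ∀ z, |b z| ≤ L) {x : ℝ} (hx : x ∈ Icc (0 : ℝ) 1) {T : ℝ} (hT : 0 ≤ T) :
    ∃ u : ℝ → ℝ, u 0 = x ∧ IsDescentOn b T u := by
  have hPL : IsPicardLindelof (fun _ z => -b z) (⟨0, left_mem_Icc.2 hT⟩ : Icc 0 T) x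
      (L * T.toNNReal) 0 L K :=
    { lipschitzOnWith := fun _ _ => hb.neg.lipschitzOnWith
      continuousOn := fun _ _ => continuousOn_const
      norm_le := fun _ _ z _ => by simpa using hbL z
      mul_max_le := by simp [hT] }
  obtain ⟨y, hy0, hy⟩ := hPL.exists_eq_forall_mem_Icc_hasDerivWithinAt₀
  have hyd : ∀ t ∈ Ioo 0 T, HasDerivAt y (-b (y t)) t := fun t ht =>
    (hy t (Ioo_subset_Icc_self ht)).hasDerivAt (Icc_mem_nhds ht.1 ht.2)
  have hyc : ContinuousOn y (Icc 0 T) := fun t ht => (hy t ht).continuousWithinAt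
  have hyanti : AntitoneOn y (Icc 0 T) := by
    refine antitoneOn_of_deriv_nonpos (convex_Icc 0 T) hyc ?_ ?_
    · rw [interior_Icc]
      exact fun t ht => (hyd t ht).differentiableAt.differentiableWithinAt
    · rw [interior_Icc]
      intro t ht
      rw [(hyd t ht).deriv]
      simpa using hb0 (y t)
  have hyL : LipschitzOnWith L y (Icc 0 T) := by
    refine (convex_Icc 0 T).lipschitzOnWith_of_nnnorm_hasDerivWithin_le hy fun t _ => ?_
    rw [← NNReal.coe_le_coe]
    simpa using hbL (y t)
  have hAC : AbsolutelyContinuousOnInterval y 0 T := by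
    rw [← uIcc_of_le hT] at hyL
    exact hyL.absolutelyContinuousOnInterval
  have hy1 : ∀ t ∈ Icc 0 T, y t ≤ 1 := fun t ht =>
    (hyanti (left_mem_Icc.2 hT) ht ht.1).trans (hy0.trans_le hx.2)
  refine ⟨fun t => max (y t) 0, ?_, hAC.lipschitz_comp (LipschitzWith.id.max_const 0),
    fun t ht => ⟨le_max_right _ _, max_le (hy1 t ht) zero_le_one⟩, ?_⟩
  · have : y 0 = x := hy0
    simp [this, hx.1]
  · refine Eventually.of_forall fun t ht => ?_
    split_ifs with h
    · refine IsLocalMin.deriv_eq_zero (Eventually.of_forall fun s => ?_)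
      exact h.trans_le (le_max_right _ _)
    · have hpos : 0 < y t := by
        by_contra! hle
        exact h (max_eq_right hle)
      have he : (fun t => max (y t) 0) =ᶠ[𝓝 t] y := by
        filter_upwards [(hyd t ht).continuousAt.eventually (lt_mem_nhds hpos)] with s hs
        exact max_eq_left hs.le
      rw [he.deriv_eq, (hyd t ht).deriv, max_eq_left hpos.le]

/-- The descent started at `x`, for all times. -/
lemma exists_descent {b : ℝ → ℝ} {K : NNReal} (hb : LipschitzWith K b) (hb0 : ∀ z, 0 ≤ b z)
    {L : NNReal} (hbL : ∀ z, |b z| ≤ L) {x : ℝ} (hx : x ∈ Icc (0 : ℝ) 1) :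
    ∃ u : ℝ → ℝ, u 0 = x ∧ LipschitzWith L u ∧ (∀ t, u t ∈ Icc (0 : ℝ) 1) ∧
      ∀ T, 0 ≤ T → IsDescentOn b T u := by
  choose U hU0 hU using fun n : ℕ => exists_isDescentOn hb hb0 hbL hx (T := (n : ℝ)) n.cast_nonneg
  have hUU : ∀ m n : ℕ, ∀ t : ℝ, 0 ≤ t → t ≤ m → t ≤ n → U m t = U n t := by
    intro m n t h0 hm hn
    exact ((hU m).mono h0 hm).eqOn hb hb0 ((hU n).mono h0 hn) ((hU0 m).trans (hU0 n).symm)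
      ⟨h0, le_rfl⟩
  -- Uniqueness glues the solutions on `[0,n]`; freezing the path at negative times makes it
  -- Lipschitz on the whole line.
  set u : ℝ → ℝ := fun t => U ⌈t⌉₊ (max t 0) with hu
  have hu_eq : ∀ n : ℕ, EqOn u (U n) (Icc 0 n) := by
    intro n t ht
    simp only [hu, max_eq_left ht.1]
    exact hUU _ _ t ht.1 (Nat.le_ceil t) ht.2
  have hdesc : ∀ T, 0 ≤ T → IsDescentOn b T u := fun T hT =>
    ((hU ⌈T⌉₊).congr (Nat.cast_nonneg _) (hu_eq _)).mono hT (Nat.le_ceil T)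
  have hmax : ∀ t, u t = u (max t 0) := by
    intro t
    rcases le_total 0 t with h | h
    · rw [max_eq_left h]
    · simp [hu, max_eq_right h, Nat.ceil_eq_zero.2 h]
  refine ⟨u, by simp [hu, hU0], LipschitzWith.of_dist_le_mul fun s t => ?_, fun t => ?_, hdesc⟩
  · rw [hmax s, hmax t]
    have h1 : dist (max s 0) (max t 0) ≤ dist s t := by
      simpa using (LipschitzWith.id.max_const (0 : ℝ)).dist_le_mul s t
    refine le_trans ?_ (mul_le_mul_of_nonneg_left h1 L.coe_nonneg)
    have hs := le_max_right s 0
    have ht := le_max_right t 0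
    rcases le_total (max s 0) (max t 0) with h | h
    · rw [dist_comm, dist_comm (max s 0), Real.dist_eq, Real.dist_eq]
      exact (hdesc _ ht).abs_sub_le hbL hs h le_rfl
    · rw [Real.dist_eq, Real.dist_eq]
      exact (hdesc _ hs).abs_sub_le hbL ht h le_rfl
  · rw [hmax t]
    exact (hdesc _ (le_max_right t 0)).mem _ ⟨le_max_right t 0, le_rfl⟩

/-! ### The potential and the lower bound on the action -/

/-- The extension of `g l` by constants outside `[0,1]`. -/
def gExt (g : Fin 2 → ℝ → ℝ) (l : Fin 2) (z : ℝ) : ℝ :=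
  g l (projIcc (0 : ℝ) 1 zero_le_one z)

lemma gExt_of_mem (g : Fin 2 → ℝ → ℝ) (l : Fin 2) {z : ℝ} (hz : z ∈ Icc (0 : ℝ) 1) :
    gExt g l z = g l z := by
  rw [gExt, projIcc_of_mem zero_le_one hz]

/-- The part of the potential that depends on the coordinate `l`. -/
def coordPotential (g : Fin 2 → ℝ → ℝ) (l : Fin 2) (z : ℝ) : ℝ :=
  ∫ y in (0 : ℝ)..z, 2 * Real.artanh (gExt g l y)

lemma coordPotential_zero (g : Fin 2 → ℝ → ℝ) (l : Fin 2) : coordPotential g l 0 = 0 := by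
  simp [coordPotential]

lemma twoStacksPotential_eq_sum (g : Fin 2 → ℝ → ℝ) {x : Pt 2} (hx : x ∈ cube 2) :
    twoStacksPotential g x = ∑ l, coordPotential g l (x l) := by
  have key : ∀ l, coordPotential g l (x l) = 2 * ∫ y in (0 : ℝ)..x l, Real.artanh (g l y) := by
    intro l
    rw [coordPotential, intervalIntegral.integral_const_mul]
    congr 1
    refine intervalIntegral.integral_congr fun y hy => ?_
    rw [uIcc_of_le (hx l).1] at hy
    simp only [gExt_of_mem g l ⟨hy.1, hy.2.trans (hx l).2⟩]
  rw [Fin.sum_univ_two, key, key, twoStacksPotential]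

lemma twoStacksPotential_zero (g : Fin 2 → ℝ → ℝ) : twoStacksPotential g 0 = 0 := by
  simp [twoStacksPotential]

lemma continuousOn_artanh : ContinuousOn Real.artanh (Ioo (-1) 1) := by
  unfold Real.artanh
  refine ContinuousOn.log (Real.continuous_sqrt.comp_continuousOn ?_) fun x hx => ?_
  · refine ContinuousOn.div (by fun_prop) (by fun_prop) fun x hx => ?_
    linarith [hx.2]
  · exact (Real.sqrt_pos.2 (div_pos (by linarith [hx.1]) (by linarith [hx.2]))).ne'

namespace TwoStacksModel

variable {P : Matrix (Fin 2) (Fin 2) ℝ} {μ lam : Fin 2 → ℝ} {g : Fin 2 → ℝ → ℝ}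

lemma gExt_mem (M : TwoStacksModel P μ lam g) (l : Fin 2) (z : ℝ) :
    gExt g l z ∈ Ico (0 : ℝ) 1 :=
  M.mem_Ico l _ (projIcc (0 : ℝ) 1 zero_le_one z).2

lemma exists_lipschitzWith_gExt (M : TwoStacksModel P μ lam g) (l : Fin 2) :
    ∃ K, LipschitzWith K (gExt g l) := by
  obtain ⟨K, hK⟩ := M.lipschitz l
  refine ⟨K, ?_⟩
  have := (lipschitzOnWith_iff_restrict.1 hK).comp (LipschitzWith.projIcc zero_le_one)
  rw [mul_one] at this
  exact this

lemma continuous_gExt (M : TwoStacksModel P μ lam g) (l : Fin 2) : Continuous (gExt g l) :=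
  (M.exists_lipschitzWith_gExt l).choose_spec.continuous

lemma continuous_slope (M : TwoStacksModel P μ lam g) (l : Fin 2) :
    Continuous fun y => 2 * Real.artanh (gExt g l y) := by
  refine continuous_const.mul ?_
  exact continuousOn_artanh.comp_continuous (M.continuous_gExt l) fun y =>
    ⟨by linarith [(M.gExt_mem l y).1], (M.gExt_mem l y).2⟩

lemma hasDerivAt_coordPotential (M : TwoStacksModel P μ lam g) (l : Fin 2) (z : ℝ) :
    HasDerivAt (coordPotential g l) (2 * Real.artanh (gExt g l z)) z :=
  intervalIntegral.integral_hasDerivAt_right ((M.continuous_slope l).intervalIntegrable _ _)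
    ((M.continuous_slope l).stronglyMeasurableAtFilter _ _) (M.continuous_slope l).continuousAt

lemma continuous_coordPotential (M : TwoStacksModel P μ lam g) (l : Fin 2) :
    Continuous (coordPotential g l) :=
  continuous_iff_continuousAt.2 fun z => (M.hasDerivAt_coordPotential l z).continuousAt

lemma coordPotential_nonneg (M : TwoStacksModel P μ lam g) (l : Fin 2) {z : ℝ} (hz : 0 ≤ z) :
    0 ≤ coordPotential g l z :=
  intervalIntegral.integral_nonneg hz fun y _ =>
    mul_nonneg zero_le_two (Real.artanh_nonneg (M.gExt_mem l y).1)

lemma twoStacksPotential_nonneg (M : TwoStacksModel P μ lam g) {x : Pt 2} (hx : x ∈ cube 2) :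
    0 ≤ twoStacksPotential g x := by
  rw [twoStacksPotential_eq_sum g hx]
  exact Finset.sum_nonneg fun l _ => M.coordPotential_nonneg l (hx l).1

lemma tendsto_twoStacksPotential (M : TwoStacksModel P μ lam g) {ι : Type*} {f : Filter ι}
    {φ : ι → Pt 2} (hcube : ∀ᶠ t in f, φ t ∈ cube 2) (hφ : Tendsto φ f (𝓝 0)) :
    Tendsto (fun t => twoStacksPotential g (φ t)) f (𝓝 0) := by
  have h1 : Tendsto (fun t => ∑ l, coordPotential g l (φ t l)) f
      (𝓝 (∑ l : Fin 2, coordPotential g l 0)) := by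
    refine tendsto_finsetSum _ fun l _ => ?_
    have h2 : Tendsto (fun t => φ t l) f (𝓝 0) := by
      exact ((lipschitzWith_coord l).continuous.tendsto (0 : Pt 2)).comp hφ
    exact ((M.continuous_coordPotential l).tendsto 0).comp h2
  simp only [coordPotential_zero, Finset.sum_const_zero] at h1
  refine h1.congr' ?_
  filter_upwards [hcube] with t ht using (twoStacksPotential_eq_sum g ht).symm

lemma exists_lipschitzWith_coordPotential (M : TwoStacksModel P μ lam g) (l : Fin 2) :
    ∃ K, LipschitzWith K (coordPotential g l) := by
  obtain ⟨C, hC⟩ := isCompact_Icc.exists_bound_of_continuousOn (s := Icc (0 : ℝ) 1)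
    (M.continuous_slope l).continuousOn
  have hC0 : 0 ≤ C := (norm_nonneg _).trans (hC 0 (left_mem_Icc.2 zero_le_one))
  refine ⟨C.toNNReal, lipschitzWith_of_nnnorm_deriv_le
    (fun z => (M.hasDerivAt_coordPotential l z).differentiableAt) fun z => ?_⟩
  rw [(M.hasDerivAt_coordPotential l z).deriv, ← NNReal.coe_le_coe, coe_nnnorm,
    Real.coe_toNNReal C hC0]
  have hp := (projIcc (0 : ℝ) 1 zero_le_one z).2
  have := hC _ hp
  rw [gExt_of_mem g l hp] at this
  exact this

/-- Along absolutely continuous paths, the potential is the integral of the optimal momentum. -/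
lemma potential_sub_eq_integral (M : TwoStacksModel P μ lam g) {φ : ℝ → Pt 2} {a b : ℝ}
    (hab : a ≤ b) (hAC : ∀ l, AbsolutelyContinuousOnInterval (fun t => φ t l) a b)
    (hcube : ∀ t ∈ Icc a b, φ t ∈ cube 2) :
    IntegrableOn (fun t => ∑ l, optimalMomentum g (φ t) l * deriv (fun t => φ t l) t) (Ioc a b) ∧
      ∫ t in Ioc a b, ∑ l, optimalMomentum g (φ t) l * deriv (fun t => φ t l) t =
        twoStacksPotential g (φ b) - twoStacksPotential g (φ a) := by
  have hW : ∀ l, AbsolutelyContinuousOnInterval (fun t => coordPotential g l (φ t l)) a b :=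
    fun l => (hAC l).lipschitz_comp (M.exists_lipschitzWith_coordPotential l).choose_spec
  have hd : ∀ l, ∀ᵐ t, t ∈ Ioo a b → deriv (fun t => coordPotential g l (φ t l)) t =
      optimalMomentum g (φ t) l * deriv (fun t => φ t l) t := by
    intro l
    filter_upwards [(hAC l).ae_differentiableAt] with t ht hmem
    have hdt := (ht (by rw [uIcc_of_le hab]; exact Ioo_subset_Icc_self hmem)).hasDerivAt
    have hc := (M.hasDerivAt_coordPotential l (φ t l)).comp t hdt
    have hmemt := hcube t (Ioo_subset_Icc_self hmem) l
    rw [Function.comp_def] at hc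
    rw [hc.deriv, optimalMomentum, gExt_of_mem g l hmemt]
    split_ifs with h0
    -- Here the momentum is `0` although the slope of the potential need not be. Both products
    -- vanish, because the coordinate is at a minimum at time `t`.
    · have : deriv (fun t => φ t l) t = 0 := by
        refine IsLocalMin.deriv_eq_zero ?_
        filter_upwards [Icc_mem_nhds hmem.1 hmem.2] with s hs
        rw [h0]
        exact (hcube s hs l).1
      rw [this, mul_zero, mul_zero]
    · rfl
  have hae : (fun t => ∑ l, deriv (fun t => coordPotential g l (φ t l)) t)
      =ᵐ[volume.restrict (Ioc a b)]
      fun t => ∑ l, optimalMomentum g (φ t) l * deriv (fun t => φ t l) t := by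
    rw [EventuallyEq, ae_restrict_iff' measurableSet_Ioc]
    refine ae_Ioc_of_ae_Ioo ?_
    filter_upwards [ae_all_iff.2 hd] with t ht hmem
    exact Finset.sum_congr rfl fun l _ => ht l hmem
  have hinteg : ∀ l, IntegrableOn (deriv fun t => coordPotential g l (φ t l)) (Ioc a b) :=
    fun l => (intervalIntegrable_iff_integrableOn_Ioc_of_le hab).1 (hW l).intervalIntegrable_deriv
  refine ⟨(integrable_finsetSum _ fun l _ => hinteg l).congr hae, ?_⟩
  rw [← integral_congr_ae hae, integral_finsetSum _ fun l _ => hinteg l,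
    twoStacksPotential_eq_sum g (hcube b (right_mem_Icc.2 hab)),
    twoStacksPotential_eq_sum g (hcube a (left_mem_Icc.2 hab)), ← Finset.sum_sub_distrib]
  refine Finset.sum_congr rfl fun l _ => ?_
  rw [← intervalIntegral.integral_of_le hab, (hW l).integral_deriv_eq_sub]

lemma lintegral_le_potential (M : TwoStacksModel P μ lam g) {φ : ℝ → Pt 2} {a b : ℝ}
    (hab : a ≤ b) (hAC : ∀ l, AbsolutelyContinuousOnInterval (fun t => φ t l) a b)
    (hcube : ∀ t ∈ Icc a b, φ t ∈ cube 2) {F : ℝ → ENNReal}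
    (hF : ∀ᵐ t, t ∈ Ioo a b →
      0 ≤ ∑ l, optimalMomentum g (φ t) l * deriv (fun t => φ t l) t ∧
      F t ≤ ENNReal.ofReal (∑ l, optimalMomentum g (φ t) l * deriv (fun t => φ t l) t)) :
    ∫⁻ t in Ioc a b, F t ≤ ENNReal.ofReal (twoStacksPotential g (φ b)) := by
  obtain ⟨hinteg, heq⟩ := M.potential_sub_eq_integral hab hAC hcube
  have hF' := (ae_restrict_iff' (μ := volume) measurableSet_Ioc).2 (ae_Ioc_of_ae_Ioo hF)
  calc ∫⁻ t in Ioc a b, F t ≤ ∫⁻ t in Ioc a b,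
        ENNReal.ofReal (∑ l, optimalMomentum g (φ t) l * deriv (fun t => φ t l) t) :=
        lintegral_mono_ae (hF'.mono fun t ht => ht.2)
    _ = ENNReal.ofReal (twoStacksPotential g (φ b) - twoStacksPotential g (φ a)) := by
        rw [← heq, ofReal_integral_eq_lintegral_ofReal hinteg (hF'.mono fun t ht => ht.1)]
    _ ≤ _ := ENNReal.ofReal_le_ofReal
        (sub_le_self _ (M.twoStacksPotential_nonneg (hcube a (left_mem_Icc.2 hab))))

/-- The verification argument. The term `η` records a surplus of cost: it is `0` for the lower
bounds and nonnegative in the uniqueness proof. -/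
lemma potential_le_lintegral (M : TwoStacksModel P μ lam g) {φ : ℝ → Pt 2} {a b : ℝ}
    (hab : a ≤ b) (hAC : ∀ l, AbsolutelyContinuousOnInterval (fun t => φ t l) a b)
    (hcube : ∀ t ∈ Icc a b, φ t ∈ cube 2) {η : ℝ → ℝ} (hη : IntegrableOn η (Ioc a b))
    {F : ℝ → ENNReal} (hF : ∀ᵐ t, t ∈ Ioo a b → ENNReal.ofReal
      (∑ l, optimalMomentum g (φ t) l * deriv (fun t => φ t l) t + η t) ≤ F t) :
    ENNReal.ofReal (twoStacksPotential g (φ b) - twoStacksPotential g (φ a) +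
      ∫ t in Ioc a b, η t) ≤ ∫⁻ t in Ioc a b, F t := by
  obtain ⟨hinteg, heq⟩ := M.potential_sub_eq_integral hab hAC hcube
  rw [← heq, ← integral_add hinteg hη]
  refine (ofReal_integral_le_lintegral (hinteg.add hη)).trans (lintegral_mono_ae ?_)
  exact (ae_restrict_iff' (μ := volume) measurableSet_Ioc).2 (ae_Ioc_of_ae_Ioo hF)

/-- The potential is a lower bound of the action of the paths started at `0`. -/
lemma potential_le_action (M : TwoStacksModel P μ lam g) (i : Fin 2) {T : ℝ} (hT : 0 < T)
    {φ : ℝ → Pt 2} (h0 : φ 0 = 0) :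
    ENNReal.ofReal (twoStacksPotential g (φ T)) ≤ action P (twoStacks lam g) i T φ := by
  refine le_iInf fun ψ => le_iInf fun hψ => le_iInf fun hrefl => ?_
  have hAC : ∀ l, AbsolutelyContinuousOnInterval (fun t => φ t l) 0 T := fun l =>
    hrefl.absolutelyContinuous_coord hT.le l (hψ.coord l)
  have hcube := hrefl.2.2.1
  have key := M.potential_le_lintegral hT.le hAC hcube (η := fun _ => 0) (integrable_zero _ _ _)
    (F := fun s => lagrangian P (twoStacks lam g) i (φ s) (deriv ψ s)) ?_
  · simpa [h0, twoStacksPotential_zero] using key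
  filter_upwards [hψ.ae_differentiableAt_pt, ae_all_iff.2 fun l => (hAC l).ae_differentiableAt]
    with t h1 h2 hmem
  have hm' : t ∈ uIcc 0 T := by rw [uIcc_of_le hT.le]; exact Ioo_subset_Icc_self hmem
  have hx := hcube t (Ioo_subset_Icc_self hmem)
  refine le_trans (ENNReal.ofReal_le_ofReal ?_)
    (M.sum_optimalMomentum_le_lagrangian i hx (deriv ψ t))
  rw [add_zero]
  refine Finset.sum_le_sum fun l _ => ?_
  have hd : HasDerivAt (fun t => ψ t l - φ t l) (deriv ψ t l - deriv (fun t => φ t l) t) t :=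
    (deriv_coord (h1 hm') l).sub (h2 l hm').hasDerivAt
  rcases eq_or_ne (φ t l) 0 with hz | hz
  · simp [optimalMomentum, hz]
  -- Off the lower face the push has nonnegative velocity and the momentum is nonnegative, so
  -- passing from `ψ` to `φ` lowers the pairing.
  · have := hrefl.deriv_push_nonneg hmem (lt_of_le_of_ne (hx l).1 hz.symm)
    rw [hd.deriv] at this
    exact mul_le_mul_of_nonneg_left (by linarith) (M.optimalMomentum_nonneg hx l)

lemma potential_le_quasiPotential (M : TwoStacksModel P μ lam g) (i : Fin 2) (x : Pt 2) :
    ENNReal.ofReal (twoStacksPotential g x) ≤ quasiPotential P (twoStacks lam g) i 0 x := by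
  refine le_iInf fun T => le_iInf fun φ => le_iInf fun hT => le_iInf fun _ => le_iInf fun _ =>
    le_iInf fun h0 => le_iInf fun hx => ?_
  rw [← hx]
  exact M.potential_le_action i hT h0

/-- The cost before `-T` is nonnegative and is dropped; the boundary term at `-T` disappears as `T`
grows. -/
lemma potential_sub_add_le_pastAction (M : TwoStacksModel P μ lam g) (i : Fin 2) {x : Pt 2}
    {φ : ℝ → Pt 2} (hφ : IsPastPath x φ)
    (hAC : ∀ T : ℝ, 0 < T → AbsolutelyContinuousOnInterval φ (-T) 0) {T : ℝ} (hT : 0 < T)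
    {η : ℝ → ℝ} (hη : IntegrableOn η (Ioc (-T) 0))
    (hF : ∀ᵐ t, t ∈ Ioo (-T) 0 → DifferentiableAt ℝ φ t →
      ENNReal.ofReal (∑ l, optimalMomentum g (φ t) l * deriv φ t l + η t) ≤
        reflectedLagrangian P (twoStacks lam g) i (φ t) (deriv φ t)) :
    ENNReal.ofReal (twoStacksPotential g x - twoStacksPotential g (φ (-T)) +
      ∫ t in Ioc (-T) 0, η t) ≤ pastAction P (twoStacks lam g) i φ := by
  have hT' : -T ≤ 0 := by linarith
  rw [pastAction, if_pos hAC]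
  have key := M.potential_le_lintegral hT' (fun l => (hAC T hT).coord l)
    (fun t ht => hφ.2.1 t ht.2) hη
    (F := fun t => reflectedLagrangian P (twoStacks lam g) i (φ t) (deriv φ t)) (by
      filter_upwards [hF, (hAC T hT).ae_differentiableAt_pt] with t h1 h2 hmem
      have hdt := h2 (by rw [uIcc_of_le hT']; exact Ioo_subset_Icc_self hmem)
      have h3 := h1 hmem hdt
      have h4 : ∀ l, deriv (fun t => φ t l) t = deriv φ t l := fun l => (deriv_coord hdt l).deriv
      simpa only [h4] using h3)
  rw [hφ.2.2.1] at key
  exact key.trans (lintegral_mono_set Ioc_subset_Iic_self)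

lemma tendsto_potential_past (M : TwoStacksModel P μ lam g) {x : Pt 2} {φ : ℝ → Pt 2}
    (hφ : IsPastPath x φ) :
    Tendsto (fun T : ℝ => twoStacksPotential g (φ (-T))) atTop (𝓝 0) :=
  M.tendsto_twoStacksPotential
    ((eventually_ge_atTop 0).mono fun T hT => hφ.2.1 (-T) (by linarith))
    (hφ.2.2.2.comp tendsto_neg_atTop_atBot)

/-- The potential is a lower bound of the action of the paths coming from `0` at time `-∞`. -/
lemma potential_le_pastAction (M : TwoStacksModel P μ lam g) (i : Fin 2) {x : Pt 2}
    {φ : ℝ → Pt 2} (hφ : IsPastPath x φ) :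
    ENNReal.ofReal (twoStacksPotential g x) ≤ pastAction P (twoStacks lam g) i φ := by
  by_cases hAC : ∀ T : ℝ, 0 < T → AbsolutelyContinuousOnInterval φ (-T) 0
  · have hlim : Tendsto (fun T : ℝ => ENNReal.ofReal
        (twoStacksPotential g x - twoStacksPotential g (φ (-T)))) atTop
        (𝓝 (ENNReal.ofReal (twoStacksPotential g x))) := by
      have := (M.tendsto_potential_past hφ).const_sub (twoStacksPotential g x)
      rw [sub_zero] at this
      exact ENNReal.tendsto_ofReal this
    refine le_of_tendsto hlim ?_
    filter_upwards [eventually_gt_atTop 0] with T hT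
    have := M.potential_sub_add_le_pastAction i hφ hAC hT (η := fun _ => 0)
      (integrable_zero _ _ _) (Eventually.of_forall fun t ht _ => by
        rw [add_zero]
        exact M.sum_optimalMomentum_le_reflectedLagrangian i (hφ.2.1 t ht.2.le) _)
    simpa using this
  · rw [pastAction, if_neg hAC]
    exact le_top

end TwoStacksModel

/-! ### Averaged dynamics and the shape of optimal paths -/

/-- The speed at which the coordinate `l` goes down under the averaged drift. -/
def descentRate (μ lam : Fin 2 → ℝ) (g : Fin 2 → ℝ → ℝ) (l : Fin 2) (z : ℝ) : ℝ :=
  speed μ lam l * gExt g l z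

lemma averagedDrift_eq_descentRate (μ lam : Fin 2 → ℝ) (g : Fin 2 → ℝ → ℝ) {x : Pt 2}
    (hx : x ∈ cube 2) (l : Fin 2) :
    averagedDrift μ (twoStacks lam g) x l = -descentRate μ lam g l (x l) := by
  rw [averagedDrift_twoStacks, descentRate, gExt_of_mem g l (hx l)]

lemma norm_le_sum_abs {d : ℕ} (v : Pt d) : ‖v‖ ≤ ∑ l, |v l| := by
  rw [EuclideanSpace.norm_eq, Real.sqrt_le_left (Finset.sum_nonneg fun _ _ => abs_nonneg _)]
  exact Finset.sum_sq_le_sq_sum_of_nonneg fun _ _ => abs_nonneg _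

namespace TwoStacksModel

variable {P : Matrix (Fin 2) (Fin 2) ℝ} {μ lam : Fin 2 → ℝ} {g : Fin 2 → ℝ → ℝ}

lemma descentRate_nonneg (M : TwoStacksModel P μ lam g) (l : Fin 2) (z : ℝ) :
    0 ≤ descentRate μ lam g l z :=
  mul_nonneg (M.speed_pos l).le (M.gExt_mem l z).1

lemma descentRate_pos (M : TwoStacksModel P μ lam g) (l : Fin 2) {z : ℝ}
    (hz : z ∈ Ioc (0 : ℝ) 1) : 0 < descentRate μ lam g l z := by
  rw [descentRate, gExt_of_mem g l ⟨hz.1.le, hz.2⟩]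
  exact mul_pos (M.speed_pos l) (M.pos l z hz)

lemma abs_descentRate_le (M : TwoStacksModel P μ lam g) (l : Fin 2) (z : ℝ) :
    |descentRate μ lam g l z| ≤ (speed μ lam l).toNNReal := by
  rw [abs_of_nonneg (M.descentRate_nonneg l z), Real.coe_toNNReal _ (M.speed_pos l).le]
  exact mul_le_of_le_one_right (M.speed_pos l).le (M.gExt_mem l z).2.le

lemma exists_lipschitzWith_descentRate (M : TwoStacksModel P μ lam g) (l : Fin 2) :
    ∃ K, LipschitzWith K (descentRate μ lam g l) := by
  obtain ⟨K, hK⟩ := M.exists_lipschitzWith_gExt l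
  exact ⟨_, (lipschitzWith_smul (speed μ lam l)).comp hK⟩

lemma continuous_descentRate (M : TwoStacksModel P μ lam g) (l : Fin 2) :
    Continuous (descentRate μ lam g l) :=
  continuous_const.mul (M.continuous_gExt l)

/-- Two paths with the same starting point that follow the averaged reflected dynamics in each
coordinate coincide. -/
lemma eq_of_isDescentOn (M : TwoStacksModel P μ lam g) {φ χ : ℝ → Pt 2} (h0 : φ 0 = χ 0)
    (hφ : ∀ l T, 0 < T → IsDescentOn (descentRate μ lam g l) T fun t => φ t l)
    (hχ : ∀ l T, 0 < T → IsDescentOn (descentRate μ lam g l) T fun t => χ t l) {t : ℝ}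
    (ht : 0 ≤ t) : φ t = χ t := by
  ext l
  obtain ⟨K, hK⟩ := M.exists_lipschitzWith_descentRate l
  have ht' : 0 < t + 1 := by linarith
  exact (hφ l _ ht').eqOn hK (M.descentRate_nonneg l) (hχ l _ ht') (by simp only [h0])
    ⟨ht, by linarith⟩

/-- A path of minimal action is, reversed in time, a descent in each coordinate. -/
lemma isDescentOn_of_pastAction_le (M : TwoStacksModel P μ lam g) (i : Fin 2) {x : Pt 2}
    {φ : ℝ → Pt 2} (hφ : IsPastPath x φ)
    (hmin : pastAction P (twoStacks lam g) i φ ≤ ENNReal.ofReal (twoStacksPotential g x))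
    (l : Fin 2) {T : ℝ} (hT : 0 < T) :
    IsDescentOn (descentRate μ lam g l) T fun t => φ (-t) l := by
  have hx : x ∈ cube 2 := hφ.2.2.1 ▸ hφ.2.1 0 le_rfl
  have hAC : ∀ T : ℝ, 0 < T → AbsolutelyContinuousOnInterval φ (-T) 0 := by
    by_contra hAC
    rw [pastAction, if_neg hAC] at hmin
    exact absurd hmin (by simp)
  obtain ⟨C, hC, κ, hκ, hexc⟩ := M.exists_excess_le_reflectedLagrangian i l
  -- The quantitative bound is used with `a = ε c`, where `c` is the velocity defect `y` truncated
  -- to `[-1,1]`, so that `|a| ≤ κ`. As `c ^ 2 ≤ c * y` and `C * ε ≤ 1 / 2`, the excess `a y - C a²`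
  -- is at least `η = (ε/2) c²`.
  set ε := min κ (1 / (2 * (C + 1))) with hε
  have hεpos : 0 < ε := lt_min hκ (by positivity)
  have hεC : C * ε ≤ 1 / 2 := by
    have h1 : ε ≤ 1 / (2 * (C + 1)) := min_le_right _ _
    rw [le_div_iff₀ (by positivity)] at h1
    nlinarith
  have hcont : Continuous fun t => φ (min t 0) :=
    hφ.1.comp_continuous (continuous_id.min continuous_const) fun t => min_le_right t 0
  have hcontl : Continuous fun t => φ (min t 0) l := (lipschitzWith_coord l).continuous.comp hcont
  set y : ℝ → ℝ := fun t =>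
    deriv (fun t => φ t l) t - descentRate μ lam g l (φ (min t 0) l) with hy
  set c : ℝ → ℝ := fun t => max (-1) (min 1 (y t)) with hc
  have hym : Measurable y :=
    (measurable_deriv _).sub ((M.continuous_descentRate l).comp hcontl).measurable
  have hcm : Measurable c := measurable_const.max (measurable_const.min hym)
  set η : ℝ → ℝ := fun t => if φ (min t 0) l = 0 then 0 else ε / 2 * c t ^ 2 with hη
  have hηm : Measurable η :=
    Measurable.ite (measurableSet_eq_fun hcontl.measurable measurable_const) measurable_const
      (measurable_const.mul (hcm.pow_const 2))
  have hc1 : ∀ t, |c t| ≤ 1 := fun t =>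
    abs_le.2 ⟨le_max_left _ _, max_le (by norm_num) (min_le_left _ _)⟩
  have hcy : ∀ t, c t ^ 2 ≤ c t * y t := by
    intro t
    simp only [hc]
    rcases le_total (y t) 1 with h1 | h1
    · rw [min_eq_right h1]
      rcases le_total (-1) (y t) with h2 | h2
      · rw [max_eq_right h2, sq]
      · rw [max_eq_left h2]; linarith
    · rw [min_eq_left h1, max_eq_right (by norm_num)]; linarith
  have hη0 : ∀ t, 0 ≤ η t := fun t => by
    simp only [hη]; split_ifs <;> positivity
  have hηint : ∀ S, IntegrableOn η (Ioc (-S) 0) := fun S => by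
    refine Integrable.of_bound (C := ε / 2) hηm.aestronglyMeasurable (Eventually.of_forall
      fun t => ?_)
    rw [Real.norm_of_nonneg (hη0 t)]
    simp only [hη]
    split_ifs
    · positivity
    · have : c t ^ 2 ≤ 1 := by rw [← sq_abs]; nlinarith [hc1 t, abs_nonneg (c t)]
      nlinarith
  have hbound : ∀ S, 0 < S → ∫ t in Ioc (-S) 0, η t ≤ twoStacksPotential g (φ (-S)) := by
    intro S hS
    have h1 := (M.potential_sub_add_le_pastAction i hφ hAC hS (hηint S)
      (Eventually.of_forall fun t hmem hd => by
        have hcube := hφ.2.1 t hmem.2.le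
        by_cases h0 : φ t l = 0
        · simp only [hη, min_eq_left hmem.2.le, h0, if_true, add_zero]
          exact M.sum_optimalMomentum_le_reflectedLagrangian i hcube _
        · refine le_trans (ENNReal.ofReal_le_ofReal (add_le_add_right ?_ _))
            (hexc (φ t) hcube h0 (deriv φ t) (ε * c t) ?_)
          · simp only [hη, min_eq_left hmem.2.le, if_neg h0]
            have hyt : y t = deriv φ t l - speed μ lam l * g l (φ t l) := by
              simp only [hy, min_eq_left hmem.2.le]
              rw [(deriv_coord hd l).deriv, descentRate, gExt_of_mem g l (hcube l)]
            rw [← hyt]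
            have h2 := mul_le_mul_of_nonneg_left (hcy t) hεpos.le
            have h3 := mul_le_mul_of_nonneg_right hεC (mul_nonneg hεpos.le (sq_nonneg (c t)))
            nlinarith
          · rw [abs_mul, abs_of_pos hεpos]
            exact (mul_le_of_le_one_right hεpos.le (hc1 t)).trans (min_le_left _ _))).trans hmin
    rw [ENNReal.ofReal_le_ofReal_iff (M.twoStacksPotential_nonneg hx)] at h1
    linarith
  -- The surplus on `[-S,0]` is at most the potential at time `-S`, which tends to `0` as `S` grows;
  -- as `η ≥ 0`, the surplus on `[-T,0]` vanishes.
  have hzero : ∫ t in Ioc (-T) 0, η t = 0 := by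
    refine le_antisymm (ge_of_tendsto (M.tendsto_potential_past hφ) ?_)
      (setIntegral_nonneg measurableSet_Ioc fun t _ => hη0 t)
    filter_upwards [eventually_ge_atTop T] with S hS
    refine le_trans ?_ (hbound S (hT.trans_le hS))
    exact setIntegral_mono_set (hηint S) (Eventually.of_forall hη0)
      (Ioc_subset_Ioc_left (by linarith)).eventuallyLE
  rw [setIntegral_eq_zero_iff_of_nonneg_ae (Eventually.of_forall hη0) (hηint T), EventuallyEq,
    ae_restrict_iff' measurableSet_Ioc] at hzero
  have hneg := (Measure.measurePreserving_neg (volume : Measure ℝ)).quasiMeasurePreserving.ae hzero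
  refine ⟨AbsolutelyContinuousOnInterval.comp_neg (f := fun t => φ t l)
    (by simpa using (hAC T hT).coord l), fun t ht => hφ.2.1 (-t) (by linarith [ht.1]) l, ?_⟩
  filter_upwards [hneg] with t ht hmem
  have hmem' : -t ∈ Ioo (-T) 0 := ⟨by linarith [hmem.2], by linarith [hmem.1]⟩
  have h1 := ht (Ioo_subset_Ioc_self hmem')
  rw [deriv_comp_neg (f := fun t => φ t l)]
  simp only [hη, min_eq_left hmem'.2.le, Pi.zero_apply] at h1
  split_ifs at h1 ⊢ with h0
  · rw [neg_eq_zero]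
    refine IsLocalMin.deriv_eq_zero ?_
    filter_upwards [Iic_mem_nhds hmem'.2] with s hs
    rw [h0]
    exact (hφ.2.1 s hs l).1
  · have hc0 : c (-t) = 0 := by
      have := (mul_eq_zero.1 h1).resolve_left (by positivity)
      exact pow_eq_zero_iff (two_ne_zero) |>.1 this
    have hy0 : y (-t) = 0 := by
      have h2 : max (-1) (min 1 (y (-t))) = 0 := hc0
      rcases le_total (y (-t)) 1 with h3 | h3
      · rw [min_eq_right h3] at h2
        rcases le_total (-1) (y (-t)) with h4 | h4
        · rwa [max_eq_right h4] at h2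
        · rw [max_eq_left h4] at h2; linarith
      · rw [min_eq_left h3, max_eq_right (by norm_num)] at h2; linarith
    simp only [hy, min_eq_left hmem'.2.le] at hy0
    linarith

/-- The primitive of the averaged drift along a path, in coordinates. -/
lemma integral_averagedDrift_apply (M : TwoStacksModel P μ lam g) {χ : ℝ → Pt 2} {t : ℝ}
    (ht : 0 ≤ t) (hχ : ContinuousOn χ (Icc 0 t)) (hcube : ∀ s ∈ Icc 0 t, χ s ∈ cube 2)
    (l : Fin 2) :
    (∫ s in (0 : ℝ)..t, averagedDrift μ (twoStacks lam g) (χ s)) l =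
      ∫ s in (0 : ℝ)..t, -descentRate μ lam g l (χ s l) := by
  have heq : EqOn (fun s => averagedDrift μ (twoStacks lam g) (χ s))
      (fun s => WithLp.toLp 2 fun l => -descentRate μ lam g l (χ s l)) (uIcc 0 t) := by
    intro s hs
    rw [uIcc_of_le ht] at hs
    ext l
    exact averagedDrift_eq_descentRate μ lam g (hcube s hs) l
  have hcont : ContinuousOn
      (fun s => (WithLp.toLp 2 fun l => -descentRate μ lam g l (χ s l) : Pt 2)) (uIcc 0 t) := by
    rw [uIcc_of_le ht]
    refine (PiLp.continuous_toLp 2 _).comp_continuousOn (continuousOn_pi.2 fun l => ?_)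
    exact ((M.continuous_descentRate l).comp_continuousOn
      ((lipschitzWith_coord l).continuous.comp_continuousOn hχ)).neg
  rw [intervalIntegral.integral_congr heq]
  have := (EuclideanSpace.proj (𝕜 := ℝ) l).intervalIntegral_comp_comm
    (hcont.intervalIntegrable (μ := volume))
  exact this.symm

/-- The solutions of the averaged reflected equation are descents in each coordinate. -/
lemma isDescentOn_of_isReflectedSolution (M : TwoStacksModel P μ lam g) {x : Pt 2} {χ : ℝ → Pt 2}
    (h : IsReflectedSolution (averagedDrift μ (twoStacks lam g)) x χ) (l : Fin 2) {T : ℝ}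
    (hT : 0 < T) : IsDescentOn (descentRate μ lam g l) T fun t => χ t l := by
  have hr := h T hT
  have hcube := hr.2.2.1
  have hrate : ContinuousOn (fun s => -descentRate μ lam g l (χ s l)) (Icc 0 T) :=
    ((M.continuous_descentRate l).comp_continuousOn (hr.continuousOn_coord l)).neg
  have hinteg : IntervalIntegrable (fun s => -descentRate μ lam g l (χ s l)) volume 0 T := by
    rw [← uIcc_of_le hT.le] at hrate
    exact hrate.intervalIntegrable
  have hw : ∀ t ∈ Icc 0 T, (x + ∫ s in (0 : ℝ)..t, averagedDrift μ (twoStacks lam g) (χ s)) l =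
      x l + ∫ s in (0 : ℝ)..t, -descentRate μ lam g l (χ s l) := by
    intro t ht
    rw [PiLp.add_apply, M.integral_averagedDrift_apply ht.1
      (hr.2.1.mono (Icc_subset_Icc_right ht.2)) fun s hs => hcube s ⟨hs.1, hs.2.trans ht.2⟩]
  have hwAC : AbsolutelyContinuousOnInterval (fun t =>
      (x + ∫ s in (0 : ℝ)..t, averagedDrift μ (twoStacks lam g) (χ s)) l) 0 T := by
    refine absolutelyContinuousOnInterval_of_dist_le
      (hinteg.absolutelyContinuousOnInterval_intervalIntegral (c := 0) left_mem_uIcc) (K := 1)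
      fun s hs t ht => ?_
    rw [uIcc_of_le hT.le] at hs ht
    simp only [hw s hs, hw t ht, dist_add_left, one_mul, le_refl]
  have hAC := hr.absolutelyContinuous_coord hT.le l hwAC
  refine ⟨hAC, fun t ht => hcube t ht l, ?_⟩
  filter_upwards [hAC.ae_differentiableAt, hinteg.ae_hasDerivAt_integral] with t h1 h2 hmem
  have hm' : t ∈ uIcc 0 T := by rw [uIcc_of_le hT.le]; exact Ioo_subset_Icc_self hmem
  have hmt := hcube t (Ioo_subset_Icc_self hmem) l
  have hd1 := (h1 hm').hasDerivAt
  have hd2 := (h2 hm' 0 left_mem_uIcc).const_add (x l)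
  have hd3 : HasDerivAt (fun t =>
      (x + ∫ s in (0 : ℝ)..t, averagedDrift μ (twoStacks lam g) (χ s)) l)
      (-descentRate μ lam g l (χ t l)) t := by
    refine hd2.congr_of_eventuallyEq ?_
    filter_upwards [Icc_mem_nhds hmem.1 hmem.2] with s hs using hw s hs
  have hk := (hd3.sub hd1).deriv
  have hk' : deriv (fun t => (x + ∫ s in (0 : ℝ)..t, averagedDrift μ (twoStacks lam g) (χ s)) l -
      χ t l) t = -descentRate μ lam g l (χ t l) - deriv (fun t => χ t l) t := hk
  split_ifs with h0
  · refine IsLocalMin.deriv_eq_zero ?_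
    filter_upwards [Icc_mem_nhds hmem.1 hmem.2] with s hs
    rw [h0]
    exact (hcube s hs l).1
  · have hpos : 0 < χ t l := lt_of_le_of_ne hmt.1 (Ne.symm h0)
    have hk1 := hr.deriv_push_nonneg hmem hpos
    rw [hk'] at hk1
    rcases eq_or_lt_of_le hmt.2 with h3 | h3
    -- On the face `1` the coordinate is at a maximum, so the push would have velocity `-descentRate
    -- < 0`, against its sign there: almost no time is spent on that face.
    · have : deriv (fun t => χ t l) t = 0 := by
        refine IsLocalMax.deriv_eq_zero ?_
        filter_upwards [Icc_mem_nhds hmem.1 hmem.2] with s hs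
        rw [h3]
        exact (hcube s hs l).2
      have := M.descentRate_pos l ⟨hpos, hmt.2⟩
      linarith
    · have hk2 := hr.deriv_push_nonpos hmem h3
      rw [hk'] at hk2
      linarith

end TwoStacksModel

/-! ### Time reversal of descents and the upper bounds -/

/-- A Lipschitz path in the square that starts at `x` and is a descent in each coordinate. -/
structure IsDescentPath (μ lam : Fin 2 → ℝ) (g : Fin 2 → ℝ → ℝ) (x : Pt 2) (χ : ℝ → Pt 2) :
    Prop where
  apply_zero : χ 0 = x
  lipschitz : ∃ K, LipschitzWith K χ
  mem_cube : ∀ t, χ t ∈ cube 2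
  descent : ∀ l T, 0 ≤ T → IsDescentOn (descentRate μ lam g l) T fun t => χ t l

/-- The rate of the pushing term at `x`. -/
def boundaryPush (μ lam : Fin 2 → ℝ) (g : Fin 2 → ℝ → ℝ) (x : Pt 2) : Pt 2 :=
  WithLp.toLp 2 fun l => if x l = 0 then -descentRate μ lam g l (x l) else 0

lemma lipschitzWith_pt {d : ℕ} {φ : ℝ → Pt d} {K : Fin d → NNReal}
    (h : ∀ l, LipschitzWith (K l) fun t => φ t l) : LipschitzWith (∑ l, K l) φ :=
  LipschitzWith.of_dist_le_mul fun s t => by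
    rw [dist_eq_norm, NNReal.coe_sum, Finset.sum_mul]
    exact (norm_le_sum_abs _).trans (Finset.sum_le_sum fun l _ => (h l).dist_le_mul s t)

namespace TwoStacksModel

variable {P : Matrix (Fin 2) (Fin 2) ℝ} {μ lam : Fin 2 → ℝ} {g : Fin 2 → ℝ → ℝ}

lemma exists_isDescentPath (M : TwoStacksModel P μ lam g) {x : Pt 2} (hx : x ∈ cube 2) :
    ∃ χ, IsDescentPath μ lam g x χ := by
  have h : ∀ l, ∃ u : ℝ → ℝ, u 0 = x l ∧ LipschitzWith (speed μ lam l).toNNReal u ∧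
      (∀ t, u t ∈ Icc (0 : ℝ) 1) ∧ ∀ T, 0 ≤ T → IsDescentOn (descentRate μ lam g l) T u :=
    fun l => exists_descent (M.exists_lipschitzWith_descentRate l).choose_spec
      (M.descentRate_nonneg l) (M.abs_descentRate_le l) (hx l)
  choose u hu0 huL humem hu using h
  exact ⟨fun t => WithLp.toLp 2 fun l => u l t, by ext l; exact hu0 l,
    ⟨_, lipschitzWith_pt fun l => huL l⟩, fun t l => humem l t, fun l T hT => hu l T hT⟩

lemma measurable_boundaryPush (M : TwoStacksModel P μ lam g) :
    Measurable (boundaryPush μ lam g) := by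
  refine (PiLp.continuous_toLp 2 _).measurable.comp (measurable_pi_lambda _ fun l => ?_)
  have hl : Measurable fun x : Pt 2 => x l := (lipschitzWith_coord l).continuous.measurable
  exact Measurable.ite (measurableSet_eq_fun hl measurable_const)
    ((M.continuous_descentRate l).measurable.comp hl).neg measurable_const

lemma norm_boundaryPush_le (M : TwoStacksModel P μ lam g) (x : Pt 2) :
    ‖boundaryPush μ lam g x‖ ≤ ∑ l, speed μ lam l := by
  refine (norm_le_sum_abs _).trans (Finset.sum_le_sum fun l _ => ?_)
  have := M.abs_descentRate_le l (x l)
  rw [Real.coe_toNNReal _ (M.speed_pos l).le] at this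
  simp only [boundaryPush]
  split_ifs
  · rwa [abs_neg]
  · rw [abs_zero]; exact (M.speed_pos l).le

lemma boundaryPush_normal (M : TwoStacksModel P μ lam g) (x : Pt 2) (l : Fin 2) :
    (x l ∈ Ioo (0 : ℝ) 1 → boundaryPush μ lam g x l = 0) ∧
      (x l = 0 → boundaryPush μ lam g x l ≤ 0) ∧ (x l = 1 → 0 ≤ boundaryPush μ lam g x l) := by
  refine ⟨fun h => ?_, fun h => ?_, fun h => ?_⟩
  · simp [boundaryPush, h.1.ne']
  · simpa [boundaryPush, h] using M.descentRate_nonneg l 0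
  · simp [boundaryPush, h]

/-- Almost everywhere, drift minus velocity equals `boundaryPush`, which is directed along the
normals; its integral is the pushing term. -/
lemma isReflectedSolution (M : TwoStacksModel P μ lam g) {x : Pt 2} {χ : ℝ → Pt 2}
    (hχ : IsDescentPath μ lam g x χ) :
    IsReflectedSolution (averagedDrift μ (twoStacks lam g)) x χ := by
  intro T hT
  obtain ⟨K, hK⟩ := hχ.lipschitz
  have hq : Measurable fun s => boundaryPush μ lam g (χ s) :=
    M.measurable_boundaryPush.comp hK.continuous.measurable
  have hqi : ∀ a b, IntegrableOn (fun s => boundaryPush μ lam g (χ s)) (Ioc a b) := fun a b =>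
    Integrable.of_bound hq.aestronglyMeasurable _
      (Eventually.of_forall fun s => M.norm_boundaryPush_le (χ s))
  have heq : ∀ t ∈ Icc 0 T, x + (∫ s in (0 : ℝ)..t, averagedDrift μ (twoStacks lam g) (χ s)) - χ t =
      ∫ s in Ioc 0 t, boundaryPush μ lam g (χ s) := by
    intro t ht
    ext l
    have hd := hχ.descent l t ht.1
    have e1 : (∫ s in Ioc 0 t, boundaryPush μ lam g (χ s)) l =
        ∫ s in (0 : ℝ)..t, boundaryPush μ lam g (χ s) l := by
      rw [intervalIntegral.integral_of_le ht.1]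
      exact ((EuclideanSpace.proj (𝕜 := ℝ) l).integral_comp_comm (hqi 0 t)).symm
    have hrate : IntervalIntegrable (fun s => -descentRate μ lam g l (χ s l)) volume 0 t :=
      (((M.continuous_descentRate l).comp
        ((lipschitzWith_coord l).continuous.comp hK.continuous)).neg).intervalIntegrable _ _
    have e2 : ∫ s in (0 : ℝ)..t, boundaryPush μ lam g (χ s) l =
        ∫ s in (0 : ℝ)..t, (-descentRate μ lam g l (χ s l) - deriv (fun t => χ t l) s) := by
      refine intervalIntegral.integral_congr_ae ?_
      rw [uIoc_of_le ht.1]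
      refine ae_Ioc_of_ae_Ioo ?_
      filter_upwards [hd.deriv_eq] with s hs hmem
      rw [hs hmem]
      simp only [boundaryPush]
      split_ifs <;> ring
    rw [e1, e2, intervalIntegral.integral_sub hrate hd.ac.intervalIntegrable_deriv,
      hd.ac.integral_deriv_eq_sub, PiLp.sub_apply, PiLp.add_apply,
      M.integral_averagedDrift_apply ht.1 hK.continuous.continuousOn fun s _ => hχ.mem_cube s]
    simp only [hχ.apply_zero]
    ring
  refine isReflection_of_density ?_ hK.continuous.continuousOn (fun t _ => hχ.mem_cube t) hq
    (fun s => M.norm_boundaryPush_le (χ s)) (fun s _ l => M.boundaryPush_normal (χ s) l) heq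
  have hcont : ContinuousOn (fun t => χ t + ∫ s in (0 : ℝ)..t, boundaryPush μ lam g (χ s))
      (Icc 0 T) := by
    refine hK.continuous.continuousOn.add ?_
    refine (intervalIntegral.continuous_primitive (fun a b => ?_) 0).continuousOn
    exact ⟨hqi a b, hqi b a⟩
  refine hcont.congr fun t ht => ?_
  have h1 := heq t ht
  rw [← intervalIntegral.integral_of_le ht.1] at h1
  simp only [← h1]
  abel

/-- The velocity of the time-reversed descent. -/
lemma ae_deriv_reversed (M : TwoStacksModel P μ lam g) {x : Pt 2} {χ : ℝ → Pt 2}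
    (hχ : IsDescentPath μ lam g x χ) (c : ℝ) :
    ∀ᵐ t, t < c → DifferentiableAt ℝ (fun t => χ (c - t)) t ∧ ∀ l, χ (c - t) l ≠ 1 ∧
      deriv (fun t => χ (c - t)) t l =
        if χ (c - t) l = 0 then 0 else speed μ lam l * g l (χ (c - t) l) := by
  obtain ⟨K, hK⟩ := hχ.lipschitz
  have h1 : ∀ᵐ s, DifferentiableAt ℝ χ s := hK.ae_differentiableAt_real
  have h2 : ∀ᵐ s, ∀ l, 0 < s → deriv (fun t => χ t l) s =
      if χ s l = 0 then 0 else -descentRate μ lam g l (χ s l) := by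
    refine ae_all_iff.2 fun l => ?_
    filter_upwards [ae_all_iff.2 fun n : ℕ => (hχ.descent l n n.cast_nonneg).deriv_eq]
      with s hs hpos
    obtain ⟨n, hn⟩ := exists_nat_gt s
    exact hs n ⟨hpos, hn⟩
  have h3 := (Measure.measurePreserving_sub_left (volume : Measure ℝ) c).quasiMeasurePreserving.ae
    (h1.and h2)
  filter_upwards [h3] with t ⟨ht1, ht2⟩ htc
  have hpos : 0 < c - t := by linarith
  have hd : HasDerivAt (fun t => χ (c - t)) (-deriv χ (c - t)) t :=
    ht1.hasDerivAt.comp_const_sub c t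
  refine ⟨hd.differentiableAt, fun l => ?_⟩
  have hdl := (deriv_coord ht1 l).deriv
  have hrate := ht2 l hpos
  rw [hdl] at hrate
  have hm := hχ.mem_cube (c - t) l
  constructor
  -- On an upper face the reversed velocity would point outward at infinite reflected cost. This
  -- concerns only a null set of times, since a maximum at `1` has zero derivative while the descent
  -- rate is positive there.
  · intro hone
    have hz : deriv (fun t => χ t l) (c - t) = 0 := by
      refine IsLocalMax.deriv_eq_zero (Eventually.of_forall fun s => ?_)
      simp only [hone]
      exact (hχ.mem_cube s l).2
    rw [← hdl, hz, if_neg (by rw [hone]; exact one_ne_zero)] at hrate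
    have := M.descentRate_pos l (z := χ (c - t) l) ⟨by rw [hone]; exact one_pos, hm.2⟩
    linarith
  · rw [hd.deriv, PiLp.neg_apply, hrate, descentRate, gExt_of_mem g l hm]
    split_ifs <;> simp

/-- The cost rate of the time-reversed descent. -/
lemma lagrangian_add_boundaryPush_le (M : TwoStacksModel P μ lam g) (i : Fin 2) {x v : Pt 2}
    (hx : x ∈ cube 2) (hv : ∀ l, v l = if x l = 0 then 0 else speed μ lam l * g l (x l)) :
    0 ≤ ∑ l, optimalMomentum g x l * v l ∧
    lagrangian P (twoStacks lam g) i x (v + boundaryPush μ lam g x) ≤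
      ENNReal.ofReal (∑ l, optimalMomentum g x l * v l) := by
  have heq : ∑ l, optimalMomentum g x l * v l =
      ∑ l, optimalMomentum g x l * (speed μ lam l * g l (x l)) := by
    refine Finset.sum_congr rfl fun l _ => ?_
    rw [hv, optimalMomentum]
    split_ifs <;> simp
  rw [heq]
  refine ⟨Finset.sum_nonneg fun l _ => mul_nonneg (M.optimalMomentum_nonneg hx l)
    (mul_nonneg (M.speed_pos l).le (M.mem_Ico l _ (hx l)).1),
    M.lagrangian_reversed_le i hx fun l => ?_⟩
  rw [PiLp.add_apply, hv]
  simp only [boundaryPush, descentRate, gExt_of_mem g l (hx l)]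
  split_ifs <;> simp

lemma isPastPath_reversed (M : TwoStacksModel P μ lam g) {x : Pt 2} {χ : ℝ → Pt 2}
    (hχ : IsDescentPath μ lam g x χ) : IsPastPath x fun t => χ (-t) := by
  obtain ⟨K, hK⟩ := hχ.lipschitz
  refine ⟨(hK.continuous.comp continuous_neg).continuousOn, fun t _ => hχ.mem_cube _,
    by simp [hχ.apply_zero], ?_⟩
  have h : Tendsto χ atTop (𝓝 0) := by
    have h1 : Tendsto (fun t => (WithLp.toLp 2 fun l => χ t l : Pt 2)) atTop
        (𝓝 (WithLp.toLp 2 fun _ => 0)) := by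
      refine ((PiLp.continuous_toLp 2 _).tendsto _).comp (tendsto_pi_nhds.2 fun l => ?_)
      exact IsDescentOn.tendsto_zero (hχ.descent l) (M.continuous_descentRate l)
        (M.descentRate_nonneg l) fun z hz => M.descentRate_pos l hz
    exact h1
  exact h.comp tendsto_neg_atBot_atTop

lemma tendsto_descent_atTop (M : TwoStacksModel P μ lam g) {x : Pt 2} {χ : ℝ → Pt 2}
    (hχ : IsDescentPath μ lam g x χ) : Tendsto χ atTop (𝓝 0) := by
  have := (M.isPastPath_reversed hχ).2.2.2.comp tendsto_neg_atTop_atBot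
  simpa [Function.comp_def] using this

/-- The action of the time-reversed descent is at most the potential. -/
lemma pastAction_reversed_le (M : TwoStacksModel P μ lam g) (i : Fin 2) {x : Pt 2} {χ : ℝ → Pt 2}
    (hχ : IsDescentPath μ lam g x χ) :
    pastAction P (twoStacks lam g) i (fun t => χ (-t)) ≤
      ENNReal.ofReal (twoStacksPotential g x) := by
  obtain ⟨K, hK⟩ := hχ.lipschitz
  have hLip : LipschitzWith (K * 1) fun t => χ (-t) := hK.comp (LipschitzWith.id.neg)
  have hAC : ∀ a b, AbsolutelyContinuousOnInterval (fun t => χ (-t)) a b := fun a b =>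
    hLip.lipschitzOnWith.absolutelyContinuousOnInterval
  rw [pastAction, if_pos fun T _ => hAC _ _]
  have hIic : Iic (0 : ℝ) = ⋃ n : ℕ, Ioc (-(n : ℝ)) 0 := by
    ext t
    simp only [mem_Iic, mem_iUnion, mem_Ioc]
    refine ⟨fun ht => ?_, fun ⟨_, h⟩ => h.2⟩
    obtain ⟨n, hn⟩ := exists_nat_gt (-t)
    exact ⟨n, by linarith, ht⟩
  have hmono : Monotone fun n : ℕ => Ioc (-(n : ℝ)) 0 := fun m n hmn =>
    Ioc_subset_Ioc_left (neg_le_neg (Nat.cast_le.2 hmn))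
  rw [hIic, setLIntegral_iUnion_of_directed _ hmono.directed_le]
  refine iSup_le fun n => ?_
  have hn : -(n : ℝ) ≤ 0 := by simp
  have key := M.lintegral_le_potential hn (fun l => (hAC _ _).coord l) (fun t _ => hχ.mem_cube (-t))
    (F := fun t => reflectedLagrangian P (twoStacks lam g) i (χ (-t)) (deriv (fun t => χ (-t)) t))
    (by
      have h0 := M.ae_deriv_reversed hχ 0
      simp only [zero_sub] at h0
      filter_upwards [h0] with t ht hmem
      obtain ⟨hd, hl⟩ := ht hmem.2
      have h1 := M.lagrangian_add_boundaryPush_le i (hχ.mem_cube (-t)) fun l => (hl l).2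
      have h4 : ∀ l, deriv (fun t => χ (-t) l) t = deriv (fun t => χ (-t)) t l := fun l =>
        (deriv_coord hd l).deriv
      simp only [h4]
      refine ⟨h1.1, le_trans ?_ h1.2⟩
      refine reflectedLagrangian_le (hχ.mem_cube (-t)) (fun l => (hl l).1) (fun l h => ?_)
        (fun l h => (M.boundaryPush_normal _ l).2.1 h) fun l h => ?_
      · rw [(hl l).2, if_pos h]
      · simp [boundaryPush, h])
  simpa [hχ.apply_zero] using key

/-- A straight line to a point of the descent followed by the time-reversed descent. -/
lemma quasiPotential_le_add (M : TwoStacksModel P μ lam g) (i : Fin 2) {K : ℝ}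
    (hK : ∀ x ∈ cube 2, ∀ v : Pt 2, ∑ l, |v l| ≤ 1 →
      lagrangian P (twoStacks lam g) i x v ≤ ENNReal.ofReal K)
    {x : Pt 2} {χ : ℝ → Pt 2} (hχ : IsDescentPath μ lam g x χ) {T τ : ℝ} (hT : 0 ≤ T)
    (hτ : 0 < τ) (hsmall : ∑ l, |χ T l| ≤ τ) :
    quasiPotential P (twoStacks lam g) i 0 x ≤
      ENNReal.ofReal (twoStacksPotential g x) + ENNReal.ofReal K * ENNReal.ofReal τ := by
  obtain ⟨C, hC⟩ := hχ.lipschitz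
  set N := T + τ with hN
  have hN0 : 0 < N := by linarith
  -- One formula for the line on `[0,τ]` and for `t ↦ χ (N - t)` afterwards: the unused piece is
  -- frozen at `χ T`, which makes `φ` globally Lipschitz.
  set φ : ℝ → Pt 2 := fun t => (min t τ / τ) • χ T + χ (T - max (t - τ) 0) - χ T with hφ
  have hφ1 : ∀ t ≤ τ, φ t = (t / τ) • χ T := by
    intro t ht
    simp [hφ, min_eq_left ht, max_eq_right (sub_nonpos.2 ht)]
  have hφ2 : ∀ t, τ ≤ t → φ t = χ (N - t) := by
    intro t ht
    simp only [hφ, min_eq_right ht, max_eq_left (sub_nonneg.2 ht), div_self hτ.ne', one_smul,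
      add_sub_cancel_left, hN]
    congr 1
    ring
  have hφL : ∃ C', LipschitzWith C' φ := by
    have h1 : LipschitzWith (1 * ‖τ⁻¹‖₊) fun t : ℝ => τ⁻¹ * min t τ := by
      have := (lipschitzWith_smul (τ⁻¹ : ℝ)).comp (LipschitzWith.id.min_const τ)
      rw [mul_one] at this
      rw [one_mul]
      exact this
    have h2 : LipschitzWith (‖χ T‖₊ * (1 * ‖τ⁻¹‖₊)) fun t : ℝ => (min t τ / τ) • χ T := by
      refine LipschitzWith.of_dist_le_mul fun s t => ?_
      have := h1.dist_le_mul s t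
      rw [dist_eq_norm, ← sub_smul, norm_smul, NNReal.coe_mul, coe_nnnorm, mul_comm, mul_assoc]
      refine mul_le_mul_of_nonneg_left ?_ (norm_nonneg _)
      rw [div_eq_inv_mul, div_eq_inv_mul, ← dist_eq_norm]
      exact this
    have h3 : LipschitzWith 1 fun t : ℝ => T - max (t - τ) 0 := by
      refine LipschitzWith.of_dist_le_mul fun s t => ?_
      have := (LipschitzWith.id.max_const (0 : ℝ)).dist_le_mul (s - τ) (t - τ)
      rw [dist_sub_left]
      simpa using this
    exact ⟨_, (h2.add (hC.comp h3)).sub (LipschitzWith.const (χ T))⟩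
  obtain ⟨C', hC'⟩ := hφL
  have hcube : ∀ t ∈ Icc 0 N, φ t ∈ cube 2 := by
    intro t ht
    rcases le_total t τ with h | h
    · rw [hφ1 t h]
      intro l
      have h1 : 0 ≤ t / τ := div_nonneg ht.1 hτ.le
      have h2 : t / τ ≤ 1 := (div_le_one hτ).2 h
      have h3 := hχ.mem_cube T l
      exact ⟨mul_nonneg h1 h3.1, mul_le_one₀ h2 h3.1 h3.2⟩
    · rw [hφ2 t h]
      exact hχ.mem_cube _
  -- No push is needed along the line. Afterwards `ψ` must carry the outward drift on the lower
  -- faces for its velocity to be the optimal one.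
  set q : ℝ → Pt 2 := fun s => if s ≤ τ then 0 else boundaryPush μ lam g (φ s) with hq
  have hqm : Measurable q := Measurable.ite measurableSet_Iic measurable_const
    (M.measurable_boundaryPush.comp hC'.continuous.measurable)
  have hS : 0 ≤ ∑ l, speed μ lam l := Finset.sum_nonneg fun l _ => (M.speed_pos l).le
  have hqB : ∀ s, ‖q s‖ ≤ ∑ l, speed μ lam l := by
    intro s
    simp only [hq]
    split_ifs
    · rwa [norm_zero]
    · exact M.norm_boundaryPush_le _
  have hqi : ∀ a b, IntervalIntegrable q volume a b := fun a b =>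
    ⟨Integrable.of_bound hqm.aestronglyMeasurable _ (Eventually.of_forall hqB),
      Integrable.of_bound hqm.aestronglyMeasurable _ (Eventually.of_forall hqB)⟩
  have hIL : LipschitzWith (∑ l, speed μ lam l).toNNReal fun t => ∫ s in (0 : ℝ)..t, q s := by
    refine LipschitzWith.of_dist_le_mul fun s t => ?_
    rw [dist_eq_norm, intervalIntegral.integral_interval_sub_left (hqi 0 s) (hqi 0 t),
      Real.coe_toNNReal _ hS, Real.dist_eq]
    exact intervalIntegral.norm_integral_le_of_norm_le_const fun r _ => hqB r
  set ψ : ℝ → Pt 2 := fun t => φ t + ∫ s in (0 : ℝ)..t, q s with hψ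
  have hψL := hC'.add hIL
  have hrefl : IsReflection N ψ φ := by
    refine isReflection_of_density hψL.continuous.continuousOn hC'.continuous.continuousOn hcube
      hqm hqB (fun s _ l => ?_) fun t ht => ?_
    · simp only [hq]
      split_ifs
      · simp
      · exact M.boundaryPush_normal (φ s) l
    · simp only [hψ, add_sub_cancel_left]
      exact intervalIntegral.integral_of_le ht.1
  have hψd : ∀ᵐ t, t ∈ Icc 0 N → ∀ v, HasDerivAt φ v t → deriv ψ t = v + q t := by
    filter_upwards [(hqi 0 N).ae_hasDerivAt_integral] with t ht hmem v hv
    exact (hv.add (ht (by rwa [uIcc_of_le hN0.le]) 0 left_mem_uIcc)).deriv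
  have hφ0 : φ 0 = 0 := by rw [hφ1 0 hτ.le]; simp
  have hφN : φ N = x := by
    rw [hφ2 N (by linarith), sub_self, hχ.apply_zero]
  have hle : quasiPotential P (twoStacks lam g) i 0 x ≤
      ∫⁻ s in Ioc 0 N, lagrangian P (twoStacks lam g) i (φ s) (deriv ψ s) := by
    refine iInf_le_of_le N (iInf_le_of_le φ (iInf_le_of_le hN0 (iInf_le_of_le
      hC'.continuous.continuousOn (iInf_le_of_le hcube (iInf_le_of_le hφ0 (iInf_le_of_le hφN ?_))))))
    exact iInf_le_of_le ψ (iInf_le_of_le hψL.lipschitzOnWith.absolutelyContinuousOnInterval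
      (iInf_le_of_le hrefl le_rfl))
  refine hle.trans ?_
  rw [← Ioc_union_Ioc_eq_Ioc hτ.le (show τ ≤ N by linarith),
    lintegral_union measurableSet_Ioc (Ioc_disjoint_Ioc_of_le le_rfl), add_comm]
  refine add_le_add ?_ ?_
  · have key := M.lintegral_le_potential (φ := φ) (show τ ≤ N by linarith)
      (fun l => AbsolutelyContinuousOnInterval.coord
        hC'.lipschitzOnWith.absolutelyContinuousOnInterval l)
      (fun t ht => hcube t ⟨hτ.le.trans ht.1, ht.2⟩)
      (F := fun t => lagrangian P (twoStacks lam g) i (φ t) (deriv ψ t)) (by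
        filter_upwards [M.ae_deriv_reversed hχ N, hψd] with t h1 h2 hmem
        obtain ⟨hd, hl⟩ := h1 hmem.2
        have he : φ =ᶠ[𝓝 t] fun t => χ (N - t) := by
          filter_upwards [Ioi_mem_nhds hmem.1] with s hs using hφ2 s (le_of_lt hs)
        have hdφ : HasDerivAt φ (deriv (fun t => χ (N - t)) t) t :=
          hd.hasDerivAt.congr_of_eventuallyEq he
        have h3 := h2 ⟨(hτ.trans hmem.1).le, hmem.2.le⟩ _ hdφ
        have h4 : ∀ l, deriv (fun t => φ t l) t = deriv (fun t => χ (N - t)) t l := fun l => by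
          rw [(deriv_coord hdφ.differentiableAt l).deriv, hdφ.deriv]
        have hqt : q t = boundaryPush μ lam g (φ t) := if_neg (not_le.2 hmem.1)
        simp only [h4]
        rw [h3, hqt]
        refine M.lagrangian_add_boundaryPush_le i (hcube t ⟨(hτ.trans hmem.1).le, hmem.2.le⟩)
          fun l => ?_
        rw [hφ2 t hmem.1.le]
        exact (hl l).2)
    rwa [hφN] at key
  · have hb : ∀ᵐ t, t ∈ Ioc 0 τ →
        lagrangian P (twoStacks lam g) i (φ t) (deriv ψ t) ≤ ENNReal.ofReal K := by
      refine ae_Ioc_of_ae_Ioo ?_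
      filter_upwards [hψd] with t h2 hmem
      have hmN : t ∈ Icc 0 N := ⟨hmem.1.le, by linarith [hmem.2]⟩
      have he : φ =ᶠ[𝓝 t] fun t => (t / τ) • χ T := by
        filter_upwards [Iio_mem_nhds hmem.2] with s hs using hφ1 s (le_of_lt hs)
      have hd : HasDerivAt (fun t : ℝ => (t / τ) • χ T) ((1 / τ) • χ T) t :=
        ((hasDerivAt_id t).div_const τ).smul_const (χ T)
      have h3 := h2 hmN _ (hd.congr_of_eventuallyEq he)
      have hqt : q t = 0 := if_pos hmem.2.le
      rw [h3, hqt, add_zero]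
      -- The line has speed `χ T / τ`, of `ℓ¹` norm at most `1` by `hsmall`.
      refine hK _ (hcube t hmN) _ ?_
      simp only [PiLp.smul_apply, smul_eq_mul, abs_mul, ← Finset.mul_sum]
      rw [abs_of_pos (one_div_pos.2 hτ), one_div, inv_mul_le_iff₀ hτ, mul_one]
      exact hsmall
    calc ∫⁻ t in Ioc 0 τ, lagrangian P (twoStacks lam g) i (φ t) (deriv ψ t)
        ≤ ∫⁻ _ in Ioc 0 τ, ENNReal.ofReal K :=
          lintegral_mono_ae ((ae_restrict_iff' measurableSet_Ioc).2 hb)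
      _ = ENNReal.ofReal K * ENNReal.ofReal τ := by
          rw [setLIntegral_const, Real.volume_Ioc, sub_zero]

/-- The quasi-potential is the potential. -/
lemma quasiPotential_eq (M : TwoStacksModel P μ lam g) (i : Fin 2) {x : Pt 2} (hx : x ∈ cube 2) :
    quasiPotential P (twoStacks lam g) i 0 x = ENNReal.ofReal (twoStacksPotential g x) := by
  refine le_antisymm ?_ (M.potential_le_quasiPotential i x)
  obtain ⟨χ, hχ⟩ := M.exists_isDescentPath hx
  obtain ⟨K, hK⟩ := M.exists_lagrangian_le i
  have hlim : Tendsto (fun τ : ℝ => ENNReal.ofReal (twoStacksPotential g x) +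
      ENNReal.ofReal K * ENNReal.ofReal τ) (𝓝[>] 0)
      (𝓝 (ENNReal.ofReal (twoStacksPotential g x) + ENNReal.ofReal K * ENNReal.ofReal 0)) :=
    ((ENNReal.Tendsto.const_mul (ENNReal.tendsto_ofReal tendsto_id)
      (Or.inr ENNReal.ofReal_ne_top)).const_add _).mono_left nhdsWithin_le_nhds
  rw [ENNReal.ofReal_zero, mul_zero, add_zero] at hlim
  -- For each `τ > 0` the descent is followed until it is within `τ` of `0` in `ℓ¹` norm, and then
  -- `τ` tends to `0`.
  refine ge_of_tendsto hlim ?_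
  filter_upwards [self_mem_nhdsWithin] with τ hτ
  have hsum : Tendsto (fun t => ∑ l, |χ t l|) atTop (𝓝 (∑ l : Fin 2, |(0 : Pt 2) l|)) :=
    tendsto_finsetSum _ fun l _ => (((lipschitzWith_coord l).continuous.tendsto (0 : Pt 2)).comp
      (M.tendsto_descent_atTop hχ)).abs
  simp only [PiLp.zero_apply, abs_zero, Finset.sum_const_zero] at hsum
  obtain ⟨T, hT, hT'⟩ := ((eventually_ge_atTop (0 : ℝ)).and
    (hsum.eventually (gt_mem_nhds hτ))).exists
  exact M.quasiPotential_le_add i hK hχ hT hτ hT'.le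

end TwoStacksModel

end

end ReflectedWalk

theorem mainTheorem5
    (P : Matrix (Fin 2) (Fin 2) ℝ) (hP : P ∈ Matrix.rowStochastic ℝ (Fin 2))
    (hirr : P.IsIrreducible)
    (μ : Fin 2 → ℝ) (hμ0 : ∀ i, 0 ≤ μ i) (hμ1 : ∑ i, μ i = 1) (hμ : Matrix.vecMul μ P = μ)
    (lam : Fin 2 → ℝ) (hlam : ∀ i, lam i ∈ Set.Ioo (0 : ℝ) 1)
    (g : Fin 2 → ℝ → ℝ)
    (hgLip : ∀ j, ∃ K : NNReal, LipschitzOnWith K (g j) (Set.Icc 0 1))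
    (hg : ∀ j, ∀ z ∈ Set.Icc (0 : ℝ) 1, g j z ∈ Set.Ico (0 : ℝ) 1)
    (hgpos : ∀ j, ∀ z ∈ Set.Ioc (0 : ℝ) 1, 0 < g j z)
    (i₀ : Fin 2) :
    (∀ x ∈ ReflectedWalk.cube 2,
      ReflectedWalk.quasiPotential P (ReflectedWalk.twoStacks lam g) i₀ 0 x =
        ENNReal.ofReal (ReflectedWalk.twoStacksPotential g x)) ∧
    ∀ x ∈ ReflectedWalk.cube 2, x ≠ 0 →
      ∃ χ : ℝ → ReflectedWalk.Pt 2,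
        ReflectedWalk.IsReflectedSolution
          (ReflectedWalk.averagedDrift μ (ReflectedWalk.twoStacks lam g)) x χ ∧
        (∀ χ' : ℝ → ReflectedWalk.Pt 2,
          ReflectedWalk.IsReflectedSolution
            (ReflectedWalk.averagedDrift μ (ReflectedWalk.twoStacks lam g)) x χ' →
          ∀ t : ℝ, 0 ≤ t → χ' t = χ t) ∧
        ReflectedWalk.IsOptimalPath P (ReflectedWalk.twoStacks lam g) i₀ x (fun t => χ (-t)) ∧
        ReflectedWalk.pastAction P (ReflectedWalk.twoStacks lam g) i₀ (fun t => χ (-t)) =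
          ReflectedWalk.quasiPotential P (ReflectedWalk.twoStacks lam g) i₀ 0 x ∧
        ∀ φ : ℝ → ReflectedWalk.Pt 2,
          ReflectedWalk.IsOptimalPath P (ReflectedWalk.twoStacks lam g) i₀ x φ →
          ∀ t : ℝ, t ≤ 0 → φ t = χ (-t) := by
  have M : ReflectedWalk.TwoStacksModel P μ lam g :=
    ⟨hP, hirr, hμ0, hμ1, hμ, hlam, hgLip, hg, hgpos⟩
  refine ⟨fun x hx => M.quasiPotential_eq i₀ hx, fun x hx _ => ?_⟩
  obtain ⟨χ, hχ⟩ := M.exists_isDescentPath hx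
  have hpast := M.isPastPath_reversed hχ
  have hle := M.pastAction_reversed_le i₀ hχ
  refine ⟨χ, M.isReflectedSolution hχ, fun χ' hχ' t ht => ?_,
    ⟨hpast, fun ψ hψ => hle.trans (M.potential_le_pastAction i₀ hψ)⟩, ?_, fun φ hφ t ht => ?_⟩
  · refine M.eq_of_isDescentOn ?_ (fun l T hT => M.isDescentOn_of_isReflectedSolution hχ' l hT)
      (fun l T hT => hχ.descent l T hT.le) ht
    rw [(hχ' 1 one_pos).apply_zero zero_le_one, hχ.apply_zero]
    simp
  · rw [M.quasiPotential_eq i₀ hx]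
    exact le_antisymm hle (M.potential_le_pastAction i₀ hpast)
  · have h := M.eq_of_isDescentOn (φ := fun t => φ (-t)) (by simp [hφ.1.2.2.1, hχ.apply_zero])
      (fun l T hT => M.isDescentOn_of_pastAction_le i₀ hφ.1 ((hφ.2 _ hpast).trans hle) l hT)
      (fun l T hT => hχ.descent l T hT.le) (neg_nonneg.2 ht)
    simpa using h
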